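/- Consider one operator $m$ (other than the operator serving the typical user, who sits at the origin of $\mathbb{R}^2$). Its base stations (BSs) $\{d_i\}_{i\in\mathbb{N}}$ form a homogeneous Poisson point process on $\mathbb{R}^2$ of density $\lambda>0$. Given the locations, the links to the origin are independently line-of-sight ($\mathrm{L}$) with probability $p(\|d_i\|)$ and non-line-of-sight ($\mathrm{N}$) otherwise, where $p:[0,\infty)\to[0,1]$ is measurable (for instance $p(r)=e^{-r/\mu}$, $\mu>0$). A BS at distance $r$ whose link is in state $\sigma\in\{\mathrm{L},\mathrm{N}\}$ has link power $C_\sigma r^{-\alpha_\sigma}$, with $C_\sigma,\alpha_\sigma>0$. Let $\theta_i$ be i.i.d. uniform on $[-\pi,\pi]$ (angle between the beam of BS $i$ and the direction of the user), and let $\beta_i$ be i.i.d. complex fading coefficients with $|\beta_i|^2\sim\mathrm{Exp}(1)$; angles, fading, and the pair (locations, link states) are mutually independent. With an integer $N\ge1$ and gains $G,g\ge0$ put $G(\theta)=G$ if $|\theta|\le\pi/N$ and $G(\theta)=g$ otherwise, so that the gain is $G$ with probability $1/N$. Let the transmit power be $P>0$, let $K\ge1$, and let $\mathcal{A}$ be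 the (almost surely unique) set of the indices of the $K$ BSs with the largest link powers. Let $$I=\sum_{i\in\mathbb{N}\setminus\mathcal{A}}P\,G(\theta_i)\,|\beta_i|^2\,C_{\sigma_i}\|d_i\|^{-\alpha_{\sigma_i}}\in[0,\infty],$$ where $\sigma_i$ is the state of the link of BS $i$. Put $p_{\mathrm L}=p$, $p_{\mathrm N}=1-p$, and for $t>0$ $$\Lambda_\sigma(t)=2\pi\lambda\int_0^{(C_\sigma/t)^{1/\alpha_\sigma}}p_\sigma(x)\,x\,dx,\qquad f_{T_K}(t)=e^{-\Lambda_{\mathrm L}(t)-\Lambda_{\mathrm N}(t)}\bigl(-\Lambda_{\mathrm L}'(t)-\Lambda_{\mathrm N}'(t)\bigr)\frac{(\Lambda_{\mathrm L}(t)+\Lambda_{\mathrm N}(t))^{K-1}}{(K-1)!}$$ (the derivatives exist for almost every $t$), and $$\ell(t)=\sum_{\sigma\in\{\mathrm{L},\mathrm{N}\}}\frac{2\pi\lambda}{\alpha_\sigma C_\sigma}\,p_\sigma\!\left(\Bigl(\frac{C_\sigma}{t}\Bigr)^{1/\alpha_\sigma}\right)\Bigl(\frac{C_\sigma}{t}\Bigr)^{2/\alpha_\sigma+1}.$$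 Then for every real $s\ge0$ $$\mathbb{E}\bigl[e^{-sI}\bigr]=\int_0^\infty\exp\left(-\left[\int_0^T\frac{sPGt}{1+sPGt}\cdot\frac1N\,\ell(t)\,dt+\int_0^T\frac{sPgt}{1+sPgt}\Bigl(1-\frac1N\Bigr)\ell(t)\,dt\right]\right)f_{T_K}(T)\,dT .$$ Here the integrals in the exponent are taken in $[0,\infty]$, $e^{-\infty}=0$, and $0\cdot\infty=0$. -/

import Mathlib

open MeasureTheory ProbabilityTheory
open scoped ENNReal NNReal

namespace MmWave

/-- The plane in which the base stations (BSs) live; the typical user sits at the origin. -/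
abbrev Plane : Type := EuclideanSpace ℝ (Fin 2)

/-- The two states of a link: line-of-sight and non-line-of-sight. -/
inductive LinkState : Type
  | los : LinkState
  | nlos : LinkState

instance : MeasurableSpace LinkState := ⊤

section PointProcess

variable {Ω E : Type*}

/-- The number of points of the family `d` that fall into `B` (with multiplicity, possibly `∞`). -/
noncomputable def pointCount (d : ℕ → Ω → E) (B : Set E) (ω : Ω) : ℕ∞ :=
  {i : ℕ | d i ω ∈ B}.encard

/-- The random points `d 0, d 1, …`, listed in any order, form a Poisson point process with
intensity measure `ν`: counts of sets of finite measure are Poisson distributed with the measure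
of the set as mean, and counts of pairwise disjoint sets are independent. -/
structure IsPoissonProcess [MeasurableSpace Ω] [MeasurableSpace E]
    (P : Measure Ω) (ν : Measure E) (d : ℕ → Ω → E) : Prop where
  measurable_point : ∀ i, Measurable (d i)
  count_law : ∀ B : Set E, MeasurableSet B → ν B ≠ ∞ →
    HasLaw (pointCount d B) ((poissonMeasure (ν B).toNNReal).map (fun n : ℕ => (n : ℕ∞))) P
  count_indep : ∀ (n : ℕ) (B : Fin n → Set E), (∀ k, MeasurableSet (B k)) →
    (∀ k, ν (B k) ≠ ∞) → Pairwise (fun k l => Disjoint (B k) (B l)) →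
    iIndepFun (fun k => pointCount d (B k)) P

end PointProcess

/-- The probability of the state `s` for a link of length `r`; `p` is the LoS probability. -/
def stateProb (p : ℝ → ℝ) (s : LinkState) (r : ℝ) : ℝ :=
  match s with
  | .los => p r
  | .nlos => 1 - p r

/-- The downlink of one operator, seen from the typical user at the origin:
* the BS locations `d i` form a homogeneous Poisson point process of density `lam`;
* given the locations, the link states `S i` are independent, with LoS probability `p ‖d i‖`;
* the angles `θ i` between the beam of BS `i` and the direction of the user are independent and
  uniform on `[-π, π]`;
* the fading coefficients `β i` are independent, with `|β i|² ∼ Exp(1)`;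
* angles, fading, and the pair (locations, states) are independent of one another. -/
structure IsOperatorNetwork {Ω : Type*} [MeasurableSpace Ω] (P : Measure Ω)
    (lam : ℝ) (p : ℝ → ℝ) (d : ℕ → Ω → Plane) (S : ℕ → Ω → LinkState)
    (θ : ℕ → Ω → ℝ) (β : ℕ → Ω → ℂ) : Prop where
  poisson : IsPoissonProcess P (ENNReal.ofReal lam • (volume : Measure Plane)) d
  measurable_state : ∀ i, Measurable (S i)
  measurable_angle : ∀ i, Measurable (θ i)
  measurable_fading : ∀ i, Measurable (β i)
  state_law : ∀ (F : Finset ℕ) (σ : ℕ → LinkState),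
    P⟦⋂ i ∈ F, S i ⁻¹' {σ i} | MeasurableSpace.comap (fun ω i => d i ω) inferInstance⟧
      =ᵐ[P] fun ω => ∏ i ∈ F, stateProb p (σ i) ‖d i ω‖
  angle_law : ∀ i, pdf.IsUniform (θ i) (Set.Icc (-Real.pi) Real.pi) P
  fading_law : ∀ i, HasLaw (fun ω => ‖β i ω‖ ^ 2) (expMeasure 1) P
  indep_links : iIndepFun (fun i ω => (θ i ω, β i ω)) P
  indep_angle_fading : ∀ i, IndepFun (θ i) (β i) P
  indep_geometry : IndepFun (fun ω => ((fun i => d i ω), (fun i => S i ω)))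
    (fun ω => ((fun i => θ i ω), (fun i => β i ω))) P

/-- The sectored antenna gain: `G` in the main lobe, of width `2π/N`, and `g` outside of it. -/
noncomputable def sectoredGain (N : ℕ) (G g : ℝ) (θ : ℝ) : ℝ :=
  open Classical in if |θ| ≤ Real.pi / N then G else g

/-- The link power `C_s r ^ (-α_s)` of a link of length `r` in state `s`. -/
noncomputable def linkPower (C α : LinkState → ℝ) (s : LinkState) (r : ℝ) : ℝ :=
  C s * r ^ (-α s)

/-- `A` consists of the indices of the `K` strongest BSs, when BS `i` has link power `t i`. -/
def IsStrongestSet (K : ℕ) (t : ℕ → ℝ) (A : Finset ℕ) : Prop :=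
  A.card = K ∧ ∀ i ∈ A, ∀ j ∉ A, t j ≤ t i

/-- The interference from all BSs outside the coordination set `A`, as a value in `[0, ∞]`. -/
noncomputable def interference {Ω : Type*} (Pow : ℝ) (N : ℕ) (G g : ℝ) (C α : LinkState → ℝ)
    (d : ℕ → Ω → Plane) (S : ℕ → Ω → LinkState) (θ : ℕ → Ω → ℝ) (β : ℕ → Ω → ℂ)
    (A : Ω → Finset ℕ) (ω : Ω) : ℝ≥0∞ :=
  ∑' i : {i : ℕ // i ∉ A ω}, ENNReal.ofReal
    (Pow * sectoredGain N G g (θ i ω) * ‖β i ω‖ ^ 2 * linkPower C α (S i ω) ‖d i ω‖)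

/-- The Laplace transform `𝔼[exp (-s X)]` of a random variable with values in `[0, ∞]`, with
`exp (-∞) = 0`. -/
noncomputable def laplaceTransform {Ω : Type*} [MeasurableSpace Ω] (P : Measure Ω)
    (X : Ω → ℝ≥0∞) (s : ℝ) : ℝ≥0∞ :=
  ∫⁻ ω, EReal.exp (-((ENNReal.ofReal s * X ω : ℝ≥0∞) : EReal)) ∂P

/-- `Λ_s(t)`, the mean number of BSs in state `s` with link power above `t`:
`2πλ ∫_0^{(C_s/t)^{1/α_s}} p_s(x) x dx`. -/
noncomputable def intensity (lam : ℝ) (p : ℝ → ℝ) (C α : LinkState → ℝ) (s : LinkState)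
    (t : ℝ) : ℝ :=
  2 * Real.pi * lam * ∫ x in (0 : ℝ)..((C s / t) ^ (1 / α s)), stateProb p s x * x

/-- The density `f_{T_K}` of the `K`-th strongest link power. -/
noncomputable def kthPowerPDF (lam : ℝ) (p : ℝ → ℝ) (C α : LinkState → ℝ) (K : ℕ)
    (t : ℝ) : ℝ :=
  Real.exp (-intensity lam p C α .los t) * Real.exp (-intensity lam p C α .nlos t) *
    (-deriv (intensity lam p C α .los) t - deriv (intensity lam p C α .nlos) t) *
    ((intensity lam p C α .los t + intensity lam p C α .nlos t) ^ (K - 1) /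
      (Nat.factorial (K - 1) : ℝ))

/-- The contribution of the state `s` to the density in `t` of the intensity measure of the link
powers. -/
noncomputable def powerDensity (lam : ℝ) (p : ℝ → ℝ) (C α : LinkState → ℝ) (s : LinkState)
    (t : ℝ) : ℝ :=
  2 * Real.pi * lam / (α s * C s) * stateProb p s ((C s / t) ^ (1 / α s)) *
    (C s / t) ^ (2 / α s + 1)

/-- The intensity measure on `(0, ∞)` of the link powers, thinned by the factor `c`. It is taken as
a positive measure: writing it as `Λ(dt)` with `Λ` the decreasing tail function gives it a minus
sign, which cancels against the orientation of `∫_T^0`. -/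
noncomputable def thinnedPowerMeasure (c lam : ℝ) (p : ℝ → ℝ) (C α : LinkState → ℝ) : Measure ℝ :=
  (volume.restrict (Set.Ioi 0)).withDensity fun t =>
    ENNReal.ofReal (c * (powerDensity lam p C α .los t + powerDensity lam p C α .nlos t))

/-- The exponent `∫_0^T (s P γ t) / (1 + s P γ t) Λ(dt)` for links of antenna gain `γ`, as a value
in `[0, ∞]`. -/
noncomputable def lobeExponent (Λ : Measure ℝ) (s Pow γ T : ℝ) : ℝ≥0∞ :=
  ∫⁻ t in Set.Ioo 0 T, ENNReal.ofReal (s * Pow * γ * t / (1 + s * Pow * γ * t)) ∂Λ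

end MmWave

open MmWave

/-!
The link powers `t i` form a Poisson process on `(0, ∞)` whose intensity measure is
`thinnedPowerMeasure 1`, with independent marks (antenna gain times fading power). Given the `K`-th
largest power `T`, the points below `T` are again a Poisson process, so the Laplace transform of
their sum is the exponential of minus the mean loss over the links weaker than `T`, and it remains
to average over the law of `T`.

No conditioning on `T` and no Palm calculus is used. Everything rests on the generating functional,
`𝔼 ∏ f (d i) = exp (-∫ (1 - f) dν)` for measurable `f` with values in `[0, 1]`
(`IsPoissonProcess.lintegral_iprod`): for simple functions it is independence of the counts, and the
general case follows by monotone approximation. Averaging over angles, fading and link states factor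
by factor carries it over to the marked process
(`IsOperatorNetwork.lintegral_iprod`), and polar coordinates followed by the substitution
`t = C r ^ (-α)` turn the integral over the plane into one over powers
(`lintegral_plane_eq_thinnedPowerMeasure`).

Inserting a factor `z` for each point of a set `B` into the functional and comparing coefficients of
the power series in `z` shows that the count of `B` is a Poisson variable independent of the points
outside of `B` (`HasPoissonFunctional.setLIntegral_count_eq`). In particular two points almost never
share a small cell, so that the link powers are almost surely distinct
(`HasPoissonFunctional.ae_ne`), and a level `a` is at most `T` exactly if at least `K` points reach
it. Discretizing `T` to a dyadic grid of mesh `2⁻ⁿ`, the event that `T` lies in the cell `[a, b)`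
depends on the points in `[a, ∞)` only, and is independent of the sum over the points below `a`.
As `n → ∞`, the sum below the grid point increases to the sum below `T`, which is the interference
(`HasPoissonFunctional.lintegral_sum_compl`).

The law of `T` is read off from `P (T < a) = poissonCDF K (Λ a)`, where `Λ` is the total intensity.
Since `p` is only measurable, `Λ` is merely locally Lipschitz; its composition with the
Poisson distribution function is absolutely continuous, and the fundamental theorem of calculus for
such functions gives the density `kthPowerPDF` (`lintegral_kthPowerPDF`).
-/

namespace MmWave

open Filter Topology

/-! ### The function `exp (-x)` on `[0, ∞]` -/

/-- The map `x ↦ exp (-x)` from `[0, ∞]` to `[0, 1]`, with `exp (-∞) = 0`. -/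
noncomputable def expNeg (x : ℝ≥0∞) : ℝ≥0∞ := EReal.exp (-(x : EReal))

lemma expNeg_eq_inv (x : ℝ≥0∞) : expNeg x = (EReal.exp (x : EReal))⁻¹ := EReal.exp_neg _

lemma expNeg_ofReal {x : ℝ} (hx : 0 ≤ x) :
    expNeg (ENNReal.ofReal x) = ENNReal.ofReal (Real.exp (-x)) := by
  rw [expNeg, EReal.coe_ennreal_ofReal, max_eq_left hx, ← EReal.coe_neg, EReal.exp_coe]

lemma expNeg_zero : expNeg 0 = 1 := by simp [expNeg]

lemma expNeg_add (x y : ℝ≥0∞) : expNeg (x + y) = expNeg x * expNeg y := by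
  have h : ∀ z : ℝ≥0∞, EReal.exp (z : EReal) ≠ 0 := fun z => by
    rw [Ne, EReal.exp_eq_zero_iff]
    exact EReal.coe_ennreal_ne_bot z
  rw [expNeg_eq_inv, expNeg_eq_inv, expNeg_eq_inv, EReal.coe_ennreal_add, EReal.exp_add,
    ENNReal.mul_inv (Or.inl (h x)) (Or.inr (h y))]

lemma continuous_expNeg : Continuous expNeg :=
  ENNReal.continuous_exp.comp (continuous_neg.comp continuous_coe_ennreal_ereal)

lemma measurable_expNeg : Measurable expNeg := continuous_expNeg.measurable

lemma antitone_expNeg : Antitone expNeg := fun _ _ h =>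
  EReal.exp_monotone (EReal.neg_le_neg_iff.2 (EReal.coe_ennreal_le_coe_ennreal_iff.2 h))

lemma expNeg_le_one (x : ℝ≥0∞) : expNeg x ≤ 1 := by
  rw [← expNeg_zero]
  exact antitone_expNeg bot_le

lemma expNeg_sum {ι : Type*} (s : Finset ι) (f : ι → ℝ≥0∞) :
    expNeg (∑ i ∈ s, f i) = ∏ i ∈ s, expNeg (f i) := by
  classical
  induction s using Finset.induction_on with
  | empty => simp [expNeg_zero]
  | insert a s ha ih => rw [Finset.sum_insert ha, Finset.prod_insert ha, expNeg_add, ih]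

/-! ### Infinite products of numbers in `[0, 1]` -/

/-- The infinite product of a sequence in `[0, 1]`: the infimum of its partial products. -/
noncomputable def iprod (a : ℕ → ℝ≥0∞) : ℝ≥0∞ := ⨅ n, ∏ i ∈ Finset.range n, a i

lemma antitone_prod_range {a : ℕ → ℝ≥0∞} (ha : ∀ i, a i ≤ 1) :
    Antitone fun n => ∏ i ∈ Finset.range n, a i :=
  antitone_nat_of_succ_le fun n => by
    rw [Finset.prod_range_succ]
    exact mul_le_of_le_one_right' (ha n)

lemma tendsto_iprod {a : ℕ → ℝ≥0∞} (ha : ∀ i, a i ≤ 1) :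
    Tendsto (fun n => ∏ i ∈ Finset.range n, a i) atTop (𝓝 (iprod a)) :=
  tendsto_atTop_iInf (antitone_prod_range ha)

lemma prod_le_one_ennreal {ι : Type*} (s : Finset ι) {a : ι → ℝ≥0∞} (ha : ∀ i, a i ≤ 1) :
    ∏ i ∈ s, a i ≤ 1 := Finset.prod_le_one' fun i _ => ha i

lemma iprod_le_one {a : ℕ → ℝ≥0∞} : iprod a ≤ 1 :=
  (iInf_le _ 0).trans (by simp)

lemma iprod_ne_top {a : ℕ → ℝ≥0∞} : iprod a ≠ ∞ :=
  (iprod_le_one.trans_lt ENNReal.one_lt_top).ne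

lemma iprod_mul {a b : ℕ → ℝ≥0∞} (ha : ∀ i, a i ≤ 1) (hb : ∀ i, b i ≤ 1) :
    iprod (fun i => a i * b i) = iprod a * iprod b := by
  refine tendsto_nhds_unique (tendsto_iprod fun i => mul_le_one' (ha i) (hb i)) ?_
  simp_rw [Finset.prod_mul_distrib]
  exact ENNReal.Tendsto.mul (tendsto_iprod ha) (Or.inr iprod_ne_top) (tendsto_iprod hb)
    (Or.inr iprod_ne_top)

lemma iprod_one : iprod (fun _ => 1) = 1 := by simp [iprod]

lemma iprod_finset_prod {ι : Type*} (s : Finset ι) {a : ι → ℕ → ℝ≥0∞}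
    (ha : ∀ k i, a k i ≤ 1) :
    iprod (fun i => ∏ k ∈ s, a k i) = ∏ k ∈ s, iprod (a k) := by
  classical
  induction s using Finset.induction_on with
  | empty => simp [iprod_one]
  | insert k s hk ih =>
    simp_rw [Finset.prod_insert hk]
    rw [iprod_mul (ha k) (fun i => prod_le_one_ennreal s fun k => ha k i), ih]

lemma iprod_expNeg (v : ℕ → ℝ≥0∞) : iprod (fun i => expNeg (v i)) = expNeg (∑' i, v i) := by
  refine tendsto_nhds_unique (tendsto_iprod fun i => expNeg_le_one _) ?_
  simp_rw [← expNeg_sum]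
  exact (continuous_expNeg.tendsto _).comp ENNReal.summable.hasSum.tendsto_sum_nat

lemma iprod_ite_of_finite {s : Set ℕ} (hs : s.Finite) [DecidablePred (· ∈ s)] {c : ℝ≥0∞}
    (hc : c ≤ 1) : iprod (fun i => if i ∈ s then c else 1) = c ^ s.ncard := by
  refine tendsto_nhds_unique (tendsto_iprod fun i => by split_ifs <;> simp [hc]) ?_
  obtain ⟨M, hM⟩ := hs.bddAbove
  refine tendsto_const_nhds.congr' ?_
  filter_upwards [eventually_gt_atTop M] with n hn
  rw [Finset.prod_ite, Finset.prod_const, Finset.prod_const_one, mul_one,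
    Set.ncard_eq_toFinset_card s hs]
  congr 2
  ext i
  simp only [Set.Finite.mem_toFinset, Finset.mem_filter, Finset.mem_range]
  exact ⟨fun h => ⟨(hM h).trans_lt hn, h⟩, fun h => h.2⟩

lemma iprod_ite_of_infinite {s : Set ℕ} (hs : s.Infinite) [DecidablePred (· ∈ s)] {c : ℝ≥0∞}
    (hc : c < 1) : iprod (fun i => if i ∈ s then c else 1) = 0 := by
  refine le_antisymm ?_ bot_le
  have h0 : Tendsto (fun k : ℕ => c ^ k) atTop (𝓝 0) :=
    ENNReal.tendsto_pow_atTop_nhds_zero_of_lt_one hc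
  refine ge_of_tendsto' h0 fun k => ?_
  obtain ⟨t, hts, htc⟩ := hs.exists_subset_card_eq k
  obtain ⟨M, hM⟩ := t.bddAbove
  refine (iInf_le _ (M + 1)).trans ?_
  rw [Finset.prod_ite, Finset.prod_const, Finset.prod_const_one, mul_one, ← htc]
  refine pow_le_pow_right_of_le_one' hc.le (Finset.card_le_card fun i hi => ?_)
  simp only [Finset.mem_filter, Finset.mem_range]
  exact ⟨Nat.lt_succ_of_le (hM hi), hts hi⟩

/-- Dominated convergence for the partial products of an infinite product in `[0, 1]`. -/
lemma tendsto_lintegral_prod_range {Ω : Type*} [MeasurableSpace Ω] (P : Measure Ω)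
    [IsProbabilityMeasure P] {a : ℕ → Ω → ℝ≥0∞} (hm : ∀ i, Measurable (a i))
    (ha : ∀ i ω, a i ω ≤ 1) :
    Tendsto (fun n => ∫⁻ ω, ∏ i ∈ Finset.range n, a i ω ∂P) atTop
      (𝓝 (∫⁻ ω, iprod (fun i => a i ω) ∂P)) := by
  refine tendsto_lintegral_of_dominated_convergence (fun _ => 1)
    (fun n => Finset.measurable_prod _ fun i _ => hm i)
    (fun n => Eventually.of_forall fun ω => prod_le_one_ennreal _ fun i => ha i ω)
    (by simp) (Eventually.of_forall fun ω => tendsto_iprod fun i => ha i ω)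

lemma measurable_iprod {Ω : Type*} [MeasurableSpace Ω] {a : ℕ → Ω → ℝ≥0∞}
    (hm : ∀ i, Measurable (a i)) : Measurable fun ω => iprod (fun i => a i ω) :=
  Measurable.iInf fun _ => Finset.measurable_prod _ fun i _ => hm i

/-! ### The generating functional of a Poisson process -/

lemma lintegral_pow_poissonMeasure (r : ℝ≥0) {c : ℝ≥0∞} (hc : c ≤ 1) :
    ∫⁻ n, c ^ n ∂(poissonMeasure r) = expNeg ((1 - c) * r) := by
  lift c to ℝ≥0 using (hc.trans_lt ENNReal.one_lt_top).ne
  have hc' : (c : ℝ) ≤ 1 := by exact_mod_cast hc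
  have h1 : (1 - (c : ℝ≥0∞)) * r = ENNReal.ofReal ((1 - c) * r) := by
    rw [ENNReal.ofReal_mul (sub_nonneg.2 hc'), ENNReal.ofReal_sub _ c.coe_nonneg]
    simp
  rw [h1, expNeg_ofReal (mul_nonneg (sub_nonneg.2 hc') r.coe_nonneg), lintegral_countable']
  simp_rw [poissonMeasure_singleton]
  have h2 : ∀ n : ℕ, (c : ℝ≥0∞) ^ n * ENNReal.ofReal (Real.exp (-r) * r ^ n / n.factorial)
      = ENNReal.ofReal (Real.exp (-r) * ((c * r : ℝ) ^ n / n.factorial)) := fun n => by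
    rw [← ENNReal.ofReal_coe_nnreal, ← ENNReal.ofReal_pow c.coe_nonneg,
      ← ENNReal.ofReal_mul (by positivity)]
    congr 1
    rw [mul_pow]; ring
  have h3 := (NormedSpace.expSeries_div_hasSum_exp (c * r : ℝ)).mul_left (Real.exp (-r))
  rw [← Real.exp_eq_exp_ℝ] at h3
  rw [tsum_congr h2, ← ENNReal.ofReal_tsum_of_nonneg (fun n => by positivity) h3.summable,
    h3.tsum_eq, ← Real.exp_add]
  congr 2
  ring

section PGFL

variable {Ω E : Type*} [MeasurableSpace Ω] [MeasurableSpace E] {P : Measure Ω}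
  {ν : Measure E} {d : ℕ → Ω → E}

lemma IsPoissonProcess.ae_finite (h : IsPoissonProcess P ν d) {B : Set E} (hB : MeasurableSet B)
    (hν : ν B ≠ ∞) : ∀ᵐ ω ∂P, {i : ℕ | d i ω ∈ B}.Finite := by
  have h1 := ((h.count_law B hB hν).ae_iff (p := fun n => n ≠ ⊤)
    (measurable_from_top)).2 (by
      rw [ae_map_iff (measurable_from_top.aemeasurable) (by measurability)]
      simp)
  filter_upwards [h1] with ω hω
  rwa [pointCount, Ne, Set.encard_eq_top_iff, Set.not_infinite] at hω

lemma IsPoissonProcess.lintegral_pow_count (h : IsPoissonProcess P ν d) {B : Set E}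
    (hB : MeasurableSet B) (hν : ν B ≠ ∞) {c : ℝ≥0∞} (hc : c ≤ 1) :
    ∫⁻ ω, c ^ (pointCount d B ω).toNat ∂P = expNeg ((1 - c) * ν B) := by
  rw [(h.count_law B hB hν).lintegral_comp (f := fun n : ℕ∞ => c ^ n.toNat)
    (measurable_from_top.aemeasurable), lintegral_map measurable_from_top measurable_from_top]
  simp only [ENat.toNat_natCast]
  rw [lintegral_pow_poissonMeasure _ hc, ENNReal.coe_toNNReal hν]

lemma IsPoissonProcess.lintegral_iprod_simpleFunc [IsProbabilityMeasure P]
    (h : IsPoissonProcess P ν d)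
    (g : SimpleFunc E ℝ≥0∞) (hg : ∀ x, g x ≤ 1) (hfin : ν (Function.support g) ≠ ∞) :
    ∫⁻ ω, iprod (fun i => 1 - g (d i ω)) ∂P = expNeg (∫⁻ x, g x ∂ν) := by
  classical
  -- the level sets of `g` for its nonzero values are disjoint and of finite measure
  set J := g.range.filter (· ≠ 0) with hJ
  let e := J.equivFin
  let c : Fin J.card → ℝ≥0∞ := fun k => (e.symm k : ℝ≥0∞)
  have hc0 : ∀ k, c k ≠ 0 := fun k => (Finset.mem_filter.1 (e.symm k).2).2
  have hcinj : Function.Injective c := Subtype.val_injective.comp e.symm.injective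
  let B : Fin J.card → Set E := fun k => g ⁻¹' {c k}
  have hB : ∀ k, MeasurableSet (B k) := fun k => g.measurableSet_fiber _
  have hν : ∀ k, ν (B k) ≠ ∞ := fun k =>
    ((measure_mono fun x (hx : g x = c k) => by
      rw [Function.mem_support, hx]; exact hc0 k).trans_lt hfin.lt_top).ne
  have hdisj : Pairwise fun k l => Disjoint (B k) (B l) := fun k l hkl =>
    Disjoint.preimage _ (by simpa using fun h => hkl (hcinj h))
  have hex : ∀ x, g x ≠ 0 → ∃ k, c k = g x := fun x hx =>
    ⟨e ⟨g x, Finset.mem_filter.2 ⟨g.mem_range_self x, hx⟩⟩, by simp [c]⟩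
  have hpt : ∀ x, 1 - g x = ∏ k, if x ∈ B k then 1 - c k else 1 := fun x => by
    by_cases hx : g x = 0
    · refine Eq.trans (by simp [hx]) (Finset.prod_eq_one fun k _ => if_neg fun hk => ?_).symm
      exact hc0 k ((show g x = c k from hk).symm.trans hx)
    · obtain ⟨k, hk⟩ := hex x hx
      refine Eq.trans ?_ (Finset.prod_eq_single k (fun l _ hl => if_neg fun h' => ?_)
        (by simp)).symm
      · rw [if_pos (show x ∈ B k from hk.symm), hk]
      · exact hl (hcinj ((show g x = c l from h').symm.trans hk.symm))
  have hint : ∫⁻ x, g x ∂ν = ∑ k, c k * ν (B k) := by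
    rw [SimpleFunc.lintegral_eq_lintegral, SimpleFunc.lintegral,
      ← Finset.sum_filter_of_ne (p := (· ≠ 0)) (fun y _ hy h0 => hy (by simp [h0])),
      ← Finset.sum_coe_sort]
    exact (Fintype.sum_equiv e _ _ fun y => by simp [c, B])
  have hcount : ∀ᵐ ω ∂P, iprod (fun i => 1 - g (d i ω))
      = ∏ k, (1 - c k) ^ (pointCount d (B k) ω).toNat := by
    filter_upwards [ae_all_iff.2 fun k => h.ae_finite (hB k) (hν k)] with ω hω
    simp_rw [hpt]
    rw [iprod_finset_prod _ fun k i => by split_ifs <;> simp]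
    exact Finset.prod_congr rfl fun k _ =>
      iprod_ite_of_finite (s := {i | d i ω ∈ B k}) (hω k) tsub_le_self
  have hmeas : ∀ k, AEMeasurable (pointCount d (B k)) P := fun k =>
    (h.count_law (B k) (hB k) (hν k)).aemeasurable
  rw [lintegral_congr_ae hcount, hint, expNeg_sum]
  have hind := (h.count_indep _ B hB hν hdisj).comp (fun k (n : ℕ∞) => (1 - c k) ^ n.toNat)
    (fun k => measurable_from_top)
  have hae : ∀ k, AEMeasurable (fun ω => (1 - c k) ^ (pointCount d (B k) ω).toNat) P := fun k =>
    (measurable_from_top (f := fun n : ℕ∞ => (1 - c k) ^ n.toNat)).comp_aemeasurable (hmeas k)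
  have hprod := lintegral_prod_eq_prod_lintegral_of_indepFun Finset.univ
    (fun k => (hae k).mk) (hind.congr fun k => (hae k).ae_eq_mk) (fun k => (hae k).measurable_mk)
  have hmk : (fun ω => ∏ k, (1 - c k) ^ (pointCount d (B k) ω).toNat)
      =ᵐ[P] fun ω => ∏ k, (hae k).mk _ ω := by
    filter_upwards [ae_all_iff.2 fun k => (hae k).ae_eq_mk] with ω hω
    exact Finset.prod_congr rfl fun k _ => hω k
  rw [lintegral_congr_ae hmk]
  refine hprod.trans (Finset.prod_congr rfl fun k _ => ?_)
  rw [← lintegral_congr_ae (hae k).ae_eq_mk]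
  refine (h.lintegral_pow_count (hB k) (hν k) tsub_le_self).trans ?_
  obtain ⟨x, hx⟩ : ∃ x, g x = c k := by
    have := (Finset.mem_filter.1 (e.symm k).2).1
    simpa using this
  rw [ENNReal.sub_sub_cancel ENNReal.one_ne_top (hx ▸ hg x)]

/-- The generating functional of a Poisson process with intensity `ν`. -/
theorem IsPoissonProcess.lintegral_iprod [IsProbabilityMeasure P] [SigmaFinite ν]
    (h : IsPoissonProcess P ν d)
    {f : E → ℝ≥0∞} (hf : Measurable f) (hf1 : ∀ x, f x ≤ 1) :
    ∫⁻ ω, iprod (fun i => f (d i ω)) ∂P = expNeg (∫⁻ x, (1 - f x) ∂ν) := by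
  classical
  have hgm : Measurable fun x => 1 - f x := measurable_const.sub hf
  -- simple functions increasing to `1 - f`, each supported on a set of finite measure
  let g : ℕ → SimpleFunc E ℝ≥0∞ := fun n =>
    (SimpleFunc.eapprox (fun x => 1 - f x) n).restrict (spanningSets ν n)
  have hg : ∀ n x, g n x = (spanningSets ν n).indicator
      (SimpleFunc.eapprox (fun x => 1 - f x) n) x := fun n x => by
    rw [SimpleFunc.restrict_apply _ (measurableSet_spanningSets ν n)]
  have hmono : ∀ x, Monotone fun n => g n x := fun x m n hmn => by
    simp only [hg]
    by_cases hx : x ∈ spanningSets ν m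
    · rw [Set.indicator_of_mem hx, Set.indicator_of_mem (monotone_spanningSets ν hmn hx)]
      exact SimpleFunc.monotone_eapprox _ hmn x
    · rw [Set.indicator_of_notMem hx]
      exact bot_le
  have hlim : ∀ x, Tendsto (fun n => g n x) atTop (𝓝 (1 - f x)) := fun x => by
    refine (SimpleFunc.tendsto_eapprox hgm x).congr' ?_
    filter_upwards [eventually_ge_atTop (spanningSetsIndex ν x)] with n hn
    rw [hg, Set.indicator_of_mem (mem_spanningSets_of_index_le ν x hn)]
  have hle : ∀ n x, g n x ≤ 1 - f x := fun n x => (hmono x).ge_of_tendsto (hlim x) n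
  have hsimple := fun n => h.lintegral_iprod_simpleFunc (g n)
    (fun x => (hle n x).trans tsub_le_self)
    (((measure_mono (Function.support_subset_iff'.2 fun x hx => by
      rw [hg, Set.indicator_of_notMem hx])).trans_lt (measure_spanningSets_lt_top ν n)).ne)
  have hR : Tendsto (fun n => expNeg (∫⁻ x, g n x ∂ν)) atTop
      (𝓝 (expNeg (∫⁻ x, (1 - f x) ∂ν))) :=
    (continuous_expNeg.tendsto _).comp (lintegral_tendsto_of_tendsto_of_monotone
      (fun n => (g n).measurable.aemeasurable) (Eventually.of_forall hmono)
      (Eventually.of_forall hlim))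
  have hptlim : ∀ ω, Tendsto (fun n => iprod fun i => 1 - g n (d i ω)) atTop
      (𝓝 (iprod fun i => f (d i ω))) := fun ω => by
    have hanti : Antitone fun n => iprod fun i => 1 - g n (d i ω) := fun m n hmn =>
      iInf_mono fun k => Finset.prod_le_prod' fun i _ => tsub_le_tsub_left (hmono _ hmn) 1
    have hinf : (⨅ n, iprod fun i => 1 - g n (d i ω)) = iprod fun i => f (d i ω) := by
      unfold iprod
      rw [iInf_comm]
      refine iInf_congr fun k => ?_
      refine tendsto_nhds_unique (tendsto_atTop_iInf fun m n hmn =>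
        Finset.prod_le_prod' fun i _ => tsub_le_tsub_left (hmono _ hmn) 1) ?_
      refine ENNReal.tendsto_finsetProd_of_ne_top _ (fun i _ => ?_) (fun i _ => ?_)
      · have := ENNReal.Tendsto.sub (tendsto_const_nhds (x := (1 : ℝ≥0∞))) (hlim (d i ω))
          (Or.inl ENNReal.one_ne_top)
        rwa [ENNReal.sub_sub_cancel ENNReal.one_ne_top (hf1 _)] at this
      · exact ((hf1 _).trans_lt ENNReal.one_lt_top).ne
    rw [← hinf]
    exact tendsto_atTop_iInf hanti
  have hL : Tendsto (fun n => ∫⁻ ω, iprod (fun i => 1 - g n (d i ω)) ∂P) atTop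
      (𝓝 (∫⁻ ω, iprod (fun i => f (d i ω)) ∂P)) :=
    tendsto_lintegral_of_dominated_convergence (fun _ => 1)
      (fun n => measurable_iprod fun i =>
        measurable_const.sub ((g n).measurable.comp (h.measurable_point i)))
      (fun n => Eventually.of_forall fun ω => iprod_le_one) (by simp)
      (Eventually.of_forall hptlim)
  simp_rw [hsimple] at hL
  exact tendsto_nhds_unique hL hR

end PGFL

/-! ### Angles and fading -/

/-- The law of the product of the antenna gain and the fading power `|β|²`: a mixture of two scaled
exponential distributions. -/
noncomputable def fadedGainLaw (N : ℕ) (G g : ℝ) : Measure ℝ :=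
  ENNReal.ofReal (1 / (N : ℝ)) • (expMeasure 1).map (fun x => G * x) +
    ENNReal.ofReal (1 - 1 / (N : ℝ)) • (expMeasure 1).map (fun x => g * x)

lemma lintegral_fadedGainLaw (N : ℕ) (G g : ℝ) {h : ℝ → ℝ≥0∞} (hh : Measurable h) :
    ∫⁻ w, h w ∂(fadedGainLaw N G g) =
      ENNReal.ofReal (1 / (N : ℝ)) * ∫⁻ x, h (G * x) ∂(expMeasure 1) +
        ENNReal.ofReal (1 - 1 / (N : ℝ)) * ∫⁻ x, h (g * x) ∂(expMeasure 1) := by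
  rw [fadedGainLaw, lintegral_add_measure, lintegral_smul_measure, lintegral_smul_measure,
    lintegral_map hh (by fun_prop), lintegral_map hh (by fun_prop)]
  rfl

lemma measurable_sectoredGain (N : ℕ) (G g : ℝ) : Measurable (sectoredGain N G g) := by
  unfold sectoredGain
  exact Measurable.ite (measurableSet_le (by fun_prop) measurable_const) measurable_const
    measurable_const

lemma uniform_main_lobe {N : ℕ} (hN : 1 ≤ N) :
    (cond volume (Set.Icc (-Real.pi) Real.pi)) {x | |x| ≤ Real.pi / N} =
      ENNReal.ofReal (1 / (N : ℝ)) := by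
  have hN' : (1 : ℝ) ≤ N := by exact_mod_cast hN
  have hpi := Real.pi_pos
  have hset : Set.Icc (-Real.pi) Real.pi ∩ {x : ℝ | |x| ≤ Real.pi / N} =
      Set.Icc (-(Real.pi / N)) (Real.pi / N) := by
    ext x
    simp only [Set.mem_inter_iff, Set.mem_Icc, Set.mem_ofPred_eq, abs_le]
    have : Real.pi / N ≤ Real.pi := div_le_self hpi.le hN'
    constructor
    · exact fun h => h.2
    · exact fun h => ⟨⟨by linarith [h.1], by linarith [h.2]⟩, h⟩
  rw [cond_apply measurableSet_Icc, hset, Real.volume_Icc, Real.volume_Icc,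
    ← ENNReal.ofReal_inv_of_pos (by linarith), ← ENNReal.ofReal_mul (by
      rw [inv_nonneg]; linarith)]
  congr 1
  field_simp

lemma lintegral_sectoredGain_uniform {N : ℕ} (hN : 1 ≤ N) (G g : ℝ) (h : ℝ → ℝ≥0∞) :
    ∫⁻ x, h (sectoredGain N G g x) ∂(cond volume (Set.Icc (-Real.pi) Real.pi)) =
      ENNReal.ofReal (1 / (N : ℝ)) * h G + ENNReal.ofReal (1 - 1 / (N : ℝ)) * h g := by
  classical
  have hS : MeasurableSet {x : ℝ | |x| ≤ Real.pi / N} :=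
    measurableSet_le (by fun_prop) measurable_const
  have hprob : IsProbabilityMeasure (cond volume (Set.Icc (-Real.pi) Real.pi)) :=
    cond_isProbabilityMeasure_of_finite (by
      rw [Real.volume_Icc, Ne, ENNReal.ofReal_eq_zero]; linarith [Real.pi_pos]) (by
      rw [Real.volume_Icc]; exact ENNReal.ofReal_ne_top)
  have hN' : (1 : ℝ) ≤ N := by exact_mod_cast hN
  rw [← lintegral_add_compl _ hS]
  congr 1
  · rw [setLIntegral_congr_fun (g := fun _ => h G) hS (fun x hx => by
      simp only [sectoredGain]; rw [if_pos (show |x| ≤ Real.pi / N from hx)]),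
      setLIntegral_const, uniform_main_lobe hN, mul_comm]
  · rw [setLIntegral_congr_fun (g := fun _ => h g) hS.compl (fun x hx => by
      simp only [sectoredGain]; rw [if_neg (show ¬|x| ≤ Real.pi / N from hx)]),
      setLIntegral_const, prob_compl_eq_one_sub hS,
      uniform_main_lobe hN, mul_comm, ENNReal.ofReal_sub _ (by positivity), ENNReal.ofReal_one]

section Network

variable {Ω : Type*} [MeasurableSpace Ω] {P : Measure Ω}
  {lam : ℝ} {p : ℝ → ℝ} {d : ℕ → Ω → Plane} {S : ℕ → Ω → LinkState}
  {θ : ℕ → Ω → ℝ} {β : ℕ → Ω → ℂ}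

/-- Antenna gain times fading power of the link `i`. -/
noncomputable def fadedGain {Ω : Type*} (N : ℕ) (G g : ℝ) (θ : ℕ → Ω → ℝ) (β : ℕ → Ω → ℂ) (i : ℕ)
    (ω : Ω) : ℝ :=
  sectoredGain N G g (θ i ω) * ‖β i ω‖ ^ 2

lemma IsOperatorNetwork.measurable_fadedGain (hnet : IsOperatorNetwork P lam p d S θ β) (N : ℕ)
    (G g : ℝ) (i : ℕ) : Measurable (fadedGain N G g θ β i) :=
  ((measurable_sectoredGain N G g).comp (hnet.measurable_angle i)).mul
    ((hnet.measurable_fading i).norm.pow_const 2)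

lemma IsOperatorNetwork.lintegral_fadedGain [IsProbabilityMeasure P]
    (hnet : IsOperatorNetwork P lam p d S θ β) {N : ℕ}
    (hN : 1 ≤ N) (G g : ℝ) (i : ℕ) {h : ℝ → ℝ≥0∞} (hh : Measurable h) :
    ∫⁻ ω, h (fadedGain N G g θ β i ω) ∂P = ∫⁻ w, h w ∂(fadedGainLaw N G g) := by
  have hind : IndepFun (θ i) (fun ω => ‖β i ω‖ ^ 2) P :=
    (hnet.indep_angle_fading i).comp measurable_id (measurable_norm.pow_const 2)
  have hm2 : Measurable fun ω => ‖β i ω‖ ^ 2 := (hnet.measurable_fading i).norm.pow_const 2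
  have hmap := (indepFun_iff_map_prod_eq_prod_map_map (hnet.measurable_angle i).aemeasurable
    hm2.aemeasurable).1 hind
  rw [(hnet.fading_law i).map_eq, hnet.angle_law i] at hmap
  have hmeas : Measurable fun q : ℝ × ℝ => h (sectoredGain N G g q.1 * q.2) :=
    hh.comp (((measurable_sectoredGain N G g).comp measurable_fst).mul measurable_snd)
  have h1 : ∫⁻ ω, h (fadedGain N G g θ β i ω) ∂P =
      ∫⁻ q, h (sectoredGain N G g q.1 * q.2) ∂(P.map fun ω => (θ i ω, ‖β i ω‖ ^ 2)) := by
    rw [lintegral_map hmeas ((hnet.measurable_angle i).prodMk hm2)]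
    rfl
  have : IsProbabilityMeasure (expMeasure 1) := isProbabilityMeasure_expMeasure one_pos
  rw [h1, hmap, lintegral_prod _ hmeas.aemeasurable, lintegral_fadedGainLaw N G g hh]
  exact lintegral_sectoredGain_uniform hN G g fun c => ∫⁻ x, h (c * x) ∂(expMeasure 1)

/-! ### Link states -/

instance : Finite LinkState :=
  Finite.of_injective (fun s : LinkState => match s with | .los => true | .nlos => false)
    (by rintro (_ | _) (_ | _) h <;> simp_all)

noncomputable instance : Fintype LinkState := Fintype.ofFinite _

lemma sum_linkState {M : Type*} [AddCommMonoid M] (f : LinkState → M) :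
    ∑ σ, f σ = f .los + f .nlos := by
  classical
  have : (Finset.univ : Finset LinkState) = {.los, .nlos} := by
    ext s
    cases s <;> simp
  rw [this, Finset.sum_pair (by simp)]

lemma measurable_stateProb (hp : Measurable p) (σ : LinkState) : Measurable (stateProb p σ) := by
  cases σ
  · exact hp
  · exact measurable_const.sub hp

lemma stateProb_nonneg (hp01 : ∀ r, 0 ≤ r → 0 ≤ p r ∧ p r ≤ 1) (σ : LinkState) {r : ℝ}
    (hr : 0 ≤ r) : 0 ≤ stateProb p σ r := by
  cases σ
  · exact (hp01 r hr).1
  · exact sub_nonneg.2 (hp01 r hr).2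

lemma stateProb_le_one (hp01 : ∀ r, 0 ≤ r → 0 ≤ p r ∧ p r ≤ 1) (σ : LinkState) {r : ℝ}
    (hr : 0 ≤ r) : stateProb p σ r ≤ 1 := by
  cases σ
  · exact (hp01 r hr).2
  · exact sub_le_self _ (hp01 r hr).1

lemma sum_ofReal_stateProb (hp01 : ∀ r, 0 ≤ r → 0 ≤ p r ∧ p r ≤ 1) {r : ℝ} (hr : 0 ≤ r) :
    ∑ σ, ENNReal.ofReal (stateProb p σ r) = 1 := by
  rw [sum_linkState, ← ENNReal.ofReal_add (stateProb_nonneg hp01 _ hr)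
    (stateProb_nonneg hp01 _ hr)]
  simp [stateProb]

lemma measurable_linkPower (C α : LinkState → ℝ) :
    Measurable fun q : LinkState × ℝ => linkPower C α q.1 q.2 :=
  measurable_from_prod_countable_right fun s => by
    unfold linkPower
    exact (measurable_id.pow_const (-α s)).const_mul (C s)

/-- The conditional law of finitely many link states, as an identity of integrals. -/
lemma IsOperatorNetwork.setLIntegral_states [IsProbabilityMeasure P]
    (hnet : IsOperatorNetwork P lam p d S θ β)
    (hp : Measurable p) (hp01 : ∀ r, 0 ≤ r → 0 ≤ p r ∧ p r ≤ 1) (F : Finset ℕ)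
    (σ : ℕ → LinkState) {h : (ℕ → Plane) → ℝ≥0∞} (hh : Measurable h) :
    ∫⁻ ω in ⋂ i ∈ F, S i ⁻¹' {σ i}, h (fun i => d i ω) ∂P =
      ∫⁻ ω, (∏ i ∈ F, ENNReal.ofReal (stateProb p (σ i) ‖d i ω‖)) * h (fun i => d i ω) ∂P := by
  set A : Set Ω := ⋂ i ∈ F, S i ⁻¹' {σ i} with hAdef
  have hA : MeasurableSet A := F.measurableSet_biInter fun i _ =>
    hnet.measurable_state i (MeasurableSet.of_discrete)
  have hD : Measurable fun ω i => d i ω := measurable_pi_lambda _ hnet.poisson.measurable_point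
  have hq : Measurable fun ω => ∏ i ∈ F, ENNReal.ofReal (stateProb p (σ i) ‖d i ω‖) :=
    Finset.measurable_prod _ fun i _ => ((measurable_stateProb hp _).comp
      (hnet.poisson.measurable_point i).norm).ennreal_ofReal
  have hm : MeasurableSpace.comap (fun ω i => d i ω) inferInstance ≤ ‹MeasurableSpace Ω› :=
    hD.comap_le
  have key : (P.restrict A).map (fun ω i => d i ω) =
      (P.withDensity fun ω => ∏ i ∈ F, ENNReal.ofReal (stateProb p (σ i) ‖d i ω‖)).map
        (fun ω i => d i ω) := by
    ext B hB
    have hDB : MeasurableSet ((fun ω i => d i ω) ⁻¹' B) := hD hB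
    rw [Measure.map_apply hD hB, Measure.map_apply hD hB, withDensity_apply _ hDB,
      Measure.restrict_apply hDB]
    have h1 := setIntegral_condExp hm (f := A.indicator fun _ => (1 : ℝ)) (μ := P)
      ((integrable_const 1).indicator hA) (s := (fun ω i => d i ω) ⁻¹' B) ⟨B, hB, rfl⟩
    rw [setIntegral_congr_ae (g := fun ω => ∏ i ∈ F, stateProb p (σ i) ‖d i ω‖) hDB
      (by filter_upwards [hnet.state_law F σ] with ω hω _ using hω),
      integral_indicator_const _ hA, measureReal_restrict_apply hA, smul_eq_mul, mul_one,
      integral_eq_lintegral_of_nonneg_ae (Eventually.of_forall fun ω => Finset.prod_nonneg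
        fun i _ => stateProb_nonneg hp01 _ (norm_nonneg _)) (by
        refine Measurable.aestronglyMeasurable ?_
        exact Finset.measurable_prod _ fun i _ => ((measurable_stateProb hp _).comp
          (hnet.poisson.measurable_point i).norm))] at h1
    simp_rw [ENNReal.ofReal_prod_of_nonneg fun i _ =>
      stateProb_nonneg (p := p) hp01 (σ i) (norm_nonneg (d i _))] at h1
    rw [Set.inter_comm, ← ENNReal.toReal_eq_toReal_iff' (measure_ne_top _ _) ?_]
    · exact h1.symm
    · refine ne_top_of_le_ne_top ENNReal.one_ne_top ((setLIntegral_le_lintegral _ _).trans ?_)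
      refine (lintegral_mono (g := fun _ => 1) fun ω => prod_le_one_ennreal _ fun i => ?_).trans
        (by simp)
      exact ENNReal.ofReal_le_one.2 (stateProb_le_one hp01 _ (norm_nonneg _))
  have h2 := congrArg (fun μ => ∫⁻ x, h x ∂μ) key
  rw [lintegral_map hh hD, lintegral_map hh hD] at h2
  exact h2.trans (lintegral_withDensity_eq_lintegral_mul _ hq (hh.comp hD))

/-- Averaging over the link states, given the locations. -/
lemma IsOperatorNetwork.lintegral_prod_states [IsProbabilityMeasure P]
    (hnet : IsOperatorNetwork P lam p d S θ β)
    (hp : Measurable p) (hp01 : ∀ r, 0 ≤ r → 0 ≤ p r ∧ p r ≤ 1) {H : LinkState → Plane → ℝ≥0∞}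
    (hH : ∀ σ, Measurable (H σ)) (m : ℕ) :
    ∫⁻ ω, ∏ i ∈ Finset.range m, H (S i ω) (d i ω) ∂P =
      ∫⁻ ω, ∏ i ∈ Finset.range m,
        ∑ σ, ENNReal.ofReal (stateProb p σ ‖d i ω‖) * H σ (d i ω) ∂P := by
  classical
  have hd := hnet.poisson.measurable_point
  -- the state law is applied to each of the finitely many configurations of the first `m` states
  have hstep : ∀ τ : Fin m → LinkState,
      ∫⁻ ω, ∏ i : Fin m, (if S i ω = τ i then H (τ i) (d i ω) else 0) ∂P =
      ∫⁻ ω, ∏ i : Fin m, ENNReal.ofReal (stateProb p (τ i) ‖d i ω‖) * H (τ i) (d i ω) ∂P := by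
    intro τ
    let τ' : ℕ → LinkState := fun i => if h : i < m then τ ⟨i, h⟩ else .los
    have hτ : ∀ i : Fin m, τ' i = τ i := fun i => by simp [τ']
    have h1 := hnet.setLIntegral_states hp hp01 (Finset.range m) τ'
      (h := fun x => ∏ i ∈ Finset.range m, H (τ' i) (x i))
      (Finset.measurable_prod _ fun i _ => (hH _).comp (measurable_pi_apply i))
    have hA : MeasurableSet (⋂ i ∈ Finset.range m, S i ⁻¹' {τ' i}) :=
      (Finset.range m).measurableSet_biInter fun i _ =>
        hnet.measurable_state i (MeasurableSet.of_discrete)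
    rw [← lintegral_indicator hA] at h1
    refine Eq.trans (lintegral_congr fun ω => ?_) (h1.trans (lintegral_congr fun ω => ?_))
    · by_cases hω : ∀ i < m, S i ω = τ' i
      · rw [Set.indicator_of_mem (by simpa using hω), Finset.prod_range]
        refine Finset.prod_congr rfl fun i _ => ?_
        rw [← hτ, if_pos (hω i i.2)]
      · rw [Set.indicator_of_notMem (by simpa using hω)]
        push Not at hω
        obtain ⟨i, hi, hne⟩ := hω
        refine Finset.prod_eq_zero (Finset.mem_univ ⟨i, hi⟩) (if_neg ?_)
        rw [← hτ]; exact hne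
    · rw [← Finset.prod_mul_distrib, Finset.prod_range]
      exact Finset.prod_congr rfl fun i _ => by rw [hτ]
  calc ∫⁻ ω, ∏ i ∈ Finset.range m, H (S i ω) (d i ω) ∂P
      = ∫⁻ ω, ∑ τ : Fin m → LinkState,
          ∏ i : Fin m, (if S i ω = τ i then H (τ i) (d i ω) else 0) ∂P := by
        refine lintegral_congr fun ω => ?_
        rw [Finset.prod_range]
        refine Eq.trans (Finset.prod_congr rfl fun i _ => ?_) (Fintype.prod_sum
          fun (i : Fin m) σ => if S i ω = σ then H σ (d i ω) else 0)
        simp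
    _ = ∫⁻ ω, ∑ τ : Fin m → LinkState,
          ∏ i : Fin m, ENNReal.ofReal (stateProb p (τ i) ‖d i ω‖) * H (τ i) (d i ω) ∂P := by
        rw [lintegral_finsetSum _ fun τ _ => ?_, lintegral_finsetSum _ fun τ _ => ?_]
        · exact Finset.sum_congr rfl fun τ _ => hstep τ
        · exact Finset.measurable_prod _ fun i _ => (((measurable_stateProb hp _).comp
            (hd i).norm).ennreal_ofReal).mul ((hH _).comp (hd i))
        · exact Finset.measurable_prod _ fun i _ => Measurable.ite
            (hnet.measurable_state i (MeasurableSet.of_discrete (s := {τ i})))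
            ((hH _).comp (hd i)) measurable_const
    _ = _ := by
        refine lintegral_congr fun ω => ?_
        rw [Finset.prod_range]
        exact (Fintype.prod_sum fun (i : Fin m) σ =>
          ENNReal.ofReal (stateProb p σ ‖d i ω‖) * H σ (d i ω)).symm

/-! ### The generating functional of the marked process -/

/-- Averaging over angles and fading, given locations and link states. -/
lemma IsOperatorNetwork.lintegral_prod_marks [IsProbabilityMeasure P]
    (hnet : IsOperatorNetwork P lam p d S θ β) {N : ℕ}
    (hN : 1 ≤ N) (G g : ℝ) (C α : LinkState → ℝ) {Φ : ℝ → ℝ → ℝ≥0∞}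
    (hΦ : Measurable (Function.uncurry Φ)) (m : ℕ) :
    ∫⁻ ω, ∏ i ∈ Finset.range m, Φ (linkPower C α (S i ω) ‖d i ω‖) (fadedGain N G g θ β i ω) ∂P =
      ∫⁻ ω, ∏ i ∈ Finset.range m,
        ∫⁻ w, Φ (linkPower C α (S i ω) ‖d i ω‖) w ∂(fadedGainLaw N G g) ∂P := by
  have hW := hnet.measurable_fadedGain N G g
  let X : Ω → (ℕ → Plane) × (ℕ → LinkState) := fun ω => (fun i => d i ω, fun i => S i ω)
  let Y : Ω → ℕ → ℝ := fun ω i => fadedGain N G g θ β i ω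
  have hX : Measurable X := (measurable_pi_lambda _ hnet.poisson.measurable_point).prodMk
    (measurable_pi_lambda _ hnet.measurable_state)
  have hY : Measurable Y := measurable_pi_lambda _ hW
  have hXY : IndepFun X Y P := hnet.indep_geometry.comp measurable_id
    (ψ := fun q : (ℕ → ℝ) × (ℕ → ℂ) => fun i => sectoredGain N G g (q.1 i) * ‖q.2 i‖ ^ 2)
    (measurable_pi_lambda _ fun i => ((measurable_sectoredGain N G g).comp
      ((measurable_pi_apply i).comp measurable_fst)).mul
      (((measurable_pi_apply i).comp measurable_snd).norm.pow_const 2))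
  have hWind : iIndepFun (fun i => fadedGain N G g θ β i) P :=
    hnet.indep_links.comp (fun _ (q : ℝ × ℂ) => sectoredGain N G g q.1 * ‖q.2‖ ^ 2)
      (fun _ => ((measurable_sectoredGain N G g).comp measurable_fst).mul
        (measurable_snd.norm.pow_const 2))
  let t : ℕ → (ℕ → Plane) × (ℕ → LinkState) → ℝ := fun i x => linkPower C α (x.2 i) ‖x.1 i‖
  have ht : ∀ i, Measurable (t i) := fun i => by
    have h1 : Measurable fun x : (ℕ → Plane) × (ℕ → LinkState) => x.2 i :=
      (measurable_pi_apply i).comp measurable_snd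
    have h2 : Measurable fun x : (ℕ → Plane) × (ℕ → LinkState) => ‖x.1 i‖ :=
      ((measurable_pi_apply i).comp measurable_fst).norm
    exact (measurable_linkPower C α).comp (h1.prodMk h2)
  have hF : Measurable fun q : ((ℕ → Plane) × (ℕ → LinkState)) × (ℕ → ℝ) =>
      ∏ i ∈ Finset.range m, Φ (t i q.1) (q.2 i) :=
    Finset.measurable_prod _ fun i _ => hΦ.comp
      (((ht i).comp measurable_fst).prodMk ((measurable_pi_apply i).comp measurable_snd))
  have hΦr : ∀ c, Measurable (Φ c) := fun c => hΦ.comp measurable_prodMk_left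
  have : IsProbabilityMeasure (P.map Y) := Measure.isProbabilityMeasure_map hY.aemeasurable
  have h1 : ∫⁻ ω, ∏ i ∈ Finset.range m, Φ (t i (X ω)) (Y ω i) ∂P =
      ∫⁻ q, ∏ i ∈ Finset.range m, Φ (t i q.1) (q.2 i) ∂(P.map fun ω => (X ω, Y ω)) := by
    rw [lintegral_map hF (hX.prodMk hY)]
  refine h1.trans ?_
  rw [(indepFun_iff_map_prod_eq_prod_map_map hX.aemeasurable hY.aemeasurable).1 hXY,
    lintegral_prod _ hF.aemeasurable, lintegral_map hF.lintegral_prod_right' hX]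
  refine lintegral_congr fun ω => ?_
  refine (lintegral_map (f := fun y : ℕ → ℝ => ∏ i ∈ Finset.range m, Φ (t i (X ω)) (y i))
    (hF.comp measurable_prodMk_left) hY).trans ?_
  refine (lintegral_prod_eq_prod_lintegral_of_indepFun (Finset.range m)
    (fun i ω' => Φ (t i (X ω)) (fadedGain N G g θ β i ω'))
    (hWind.comp (fun i => Φ (t i (X ω))) fun i => hΦr _) fun i => (hΦr _).comp (hW i)).trans ?_
  exact Finset.prod_congr rfl fun i _ => hnet.lintegral_fadedGain hN G g i (hΦr _)

/-- The generating functional of the link powers, marked with gain and fading. -/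
theorem IsOperatorNetwork.lintegral_iprod [IsProbabilityMeasure P]
    (hnet : IsOperatorNetwork P lam p d S θ β)
    (hp : Measurable p) (hp01 : ∀ r, 0 ≤ r → 0 ≤ p r ∧ p r ≤ 1) {N : ℕ}
    (hN : 1 ≤ N) (G g : ℝ) (C α : LinkState → ℝ) {Φ : ℝ → ℝ → ℝ≥0∞}
    (hΦ : Measurable (Function.uncurry Φ)) (hΦ1 : ∀ t w, Φ t w ≤ 1) :
    ∫⁻ ω, iprod (fun i => Φ (linkPower C α (S i ω) ‖d i ω‖) (fadedGain N G g θ β i ω)) ∂P =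
      expNeg (∫⁻ x : Plane, ∑ σ, ENNReal.ofReal (stateProb p σ ‖x‖) *
        (1 - ∫⁻ w, Φ (linkPower C α σ ‖x‖) w ∂(fadedGainLaw N G g))
          ∂(ENNReal.ofReal lam • (volume : Measure Plane))) := by
  have hd := hnet.poisson.measurable_point
  have hlawfin : ∀ c, ∫⁻ w, Φ c w ∂(fadedGainLaw N G g) ≤ 1 := fun c => by
    rw [← hnet.lintegral_fadedGain hN G g 0 (h := Φ c) (hΦ.comp measurable_prodMk_left)]
    exact (lintegral_mono fun ω => hΦ1 _ _).trans (by simp)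
  have hsf : SFinite (fadedGainLaw N G g) := by
    have : IsProbabilityMeasure (expMeasure 1) := isProbabilityMeasure_expMeasure one_pos
    unfold fadedGainLaw
    infer_instance
  have hΦ2 : Measurable fun c => ∫⁻ w, Φ c w ∂(fadedGainLaw N G g) := hΦ.lintegral_prod_right'
  let f : Plane → ℝ≥0∞ := fun x => ∑ σ, ENNReal.ofReal (stateProb p σ ‖x‖) *
    ∫⁻ w, Φ (linkPower C α σ ‖x‖) w ∂(fadedGainLaw N G g)
  have hlp : ∀ σ, Measurable fun x : Plane => linkPower C α σ ‖x‖ := fun σ =>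
    (measurable_linkPower C α).comp (measurable_const.prodMk measurable_norm)
  have hf : Measurable f := Finset.measurable_sum _ fun σ _ =>
    (((measurable_stateProb hp σ).comp measurable_norm).ennreal_ofReal).mul (hΦ2.comp (hlp σ))
  have hadd : ∀ x : Plane, (∑ σ, ENNReal.ofReal (stateProb p σ ‖x‖) *
      (1 - ∫⁻ w, Φ (linkPower C α σ ‖x‖) w ∂(fadedGainLaw N G g))) + f x = 1 := fun x => by
    rw [← Finset.sum_add_distrib]
    refine Eq.trans (Finset.sum_congr rfl fun σ _ => ?_)
      (sum_ofReal_stateProb hp01 (norm_nonneg x))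
    rw [← mul_add, tsub_add_cancel_of_le (hlawfin _), mul_one]
  have hf1 : ∀ x, f x ≤ 1 := fun x => (le_add_self).trans (hadd x).le
  have hsub : ∀ x, 1 - f x = ∑ σ, ENNReal.ofReal (stateProb p σ ‖x‖) *
      (1 - ∫⁻ w, Φ (linkPower C α σ ‖x‖) w ∂(fadedGainLaw N G g)) := fun x =>
    (ENNReal.eq_sub_of_add_eq ((hf1 x).trans_lt ENNReal.one_lt_top).ne (hadd x)).symm
  simp_rw [← hsub]
  have : SigmaFinite (ENNReal.ofReal lam • (volume : Measure Plane)) :=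
    SMul.sigmaFinite (μ := (volume : Measure Plane)) lam.toNNReal
  rw [← hnet.poisson.lintegral_iprod hf hf1]
  refine tendsto_nhds_unique (tendsto_lintegral_prod_range P (fun i => hΦ.comp
    (((measurable_linkPower C α).comp ((hnet.measurable_state i).prodMk (hd i).norm)).prodMk
      (hnet.measurable_fadedGain N G g i))) fun i ω => hΦ1 _ _) ?_
  refine (tendsto_lintegral_prod_range P (fun i => hf.comp (hd i)) fun i ω => hf1 _).congr
    fun m => ?_
  rw [Function.uncurry_def] at *
  refine Eq.trans ?_ (hnet.lintegral_prod_marks hN G g C α hΦ m).symm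
  exact (hnet.lintegral_prod_states hp hp01
    (H := fun σ x => ∫⁻ w, Φ (linkPower C α σ ‖x‖) w ∂(fadedGainLaw N G g))
    (fun σ => hΦ2.comp (hlp σ)) m).symm

end Network

/-! ### The intensity measure of the link powers -/

/-- Polar coordinates in the plane, for radial functions. -/
lemma lintegral_plane_norm {F : ℝ → ℝ≥0∞} (hF : Measurable F) :
    ∫⁻ x : Plane, F ‖x‖ =
      ENNReal.ofReal (2 * Real.pi) * ∫⁻ r in Set.Ioi (0 : ℝ), ENNReal.ofReal r * F r := by
  have hdim : Module.finrank ℝ Plane = 2 := by simp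
  have hmp := (volume : Measure Plane).measurePreserving_homeomorphUnitSphereProd
  rw [hdim] at hmp
  have h1 : ∫⁻ x : Plane, F ‖x‖ =
      ∫⁻ x : ({0}ᶜ : Set Plane), F ‖x.1‖ ∂(Measure.comap Subtype.val volume) := by
    rw [lintegral_subtype_comap (measurableSet_singleton _).compl (fun x : Plane => F ‖x‖),
      restrict_compl_singleton]
  have hF2 : Measurable fun r : Set.Ioi (0 : ℝ) => F r := hF.comp measurable_subtype_coe
  have hF3 : Measurable fun q : Metric.sphere (0 : Plane) 1 × Set.Ioi (0 : ℝ) => F q.2 :=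
    hF2.comp measurable_snd
  have h2 : ∫⁻ x : ({0}ᶜ : Set Plane), F ‖x.1‖ ∂(Measure.comap Subtype.val volume) =
      ∫⁻ q, F (q.2 : Set.Ioi (0 : ℝ)) ∂((volume : Measure Plane).toSphere.prod
        (Measure.volumeIoiPow (2 - 1))) := by
    rw [← hmp.lintegral_comp hF3]
    exact lintegral_congr fun x => by simp
  have h3 : (volume : Measure Plane).toSphere Set.univ = ENNReal.ofReal (2 * Real.pi) := by
    rw [Measure.toSphere_apply_univ, hdim, EuclideanSpace.volume_ball_fin_two]
    rw [ENNReal.ofReal_mul zero_le_two]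
    simp [ENNReal.ofReal, Real.toNNReal_of_nonneg Real.pi_pos.le]
  rw [h1, h2, lintegral_prod _ hF3.aemeasurable]
  simp only [lintegral_const]
  rw [h3, mul_comm, Measure.volumeIoiPow, lintegral_withDensity_eq_lintegral_mul _
    (by fun_prop) hF2]
  congr 1
  simp only [Pi.mul_apply]
  rw [lintegral_subtype_comap measurableSet_Ioi
    (fun r : ℝ => ENNReal.ofReal (r ^ (2 - 1)) * F r)]
  simp

lemma injOn_div_rpow {c a : ℝ} (hc : 0 < c) (ha : 0 < a) :
    Set.InjOn (fun t : ℝ => (c / t) ^ (1 / a)) (Set.Ioi 0) := fun x hx y hy h => by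
  have hx : 0 < x := hx
  have hy : 0 < y := hy
  have h2 := (Real.rpow_left_inj (by positivity) (by positivity)
    (one_div_pos.2 ha).ne').1 h
  rw [div_eq_div_iff hx.ne' hy.ne'] at h2
  exact (mul_left_cancel₀ hc.ne' h2).symm

lemma mul_div_rpow_rpow_neg {c a t : ℝ} (hc : 0 < c) (ha : 0 < a) (ht : 0 < t) :
    c * ((c / t) ^ (1 / a)) ^ (-a) = t := by
  rw [← Real.rpow_mul (by positivity), mul_neg, one_div_mul_cancel ha.ne', Real.rpow_neg_one]
  field_simp

/-- The substitution `t = c r ^ (-a)` in polar coordinates. -/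
lemma lintegral_radius_eq_lintegral_power {c a : ℝ} (hc : 0 < c) (ha : 0 < a) (F : ℝ → ℝ≥0∞) :
    ∫⁻ r in Set.Ioi (0 : ℝ), ENNReal.ofReal r * F r =
      ∫⁻ t in Set.Ioi (0 : ℝ), ENNReal.ofReal (1 / (a * c) * (c / t) ^ (2 / a + 1)) *
        F ((c / t) ^ (1 / a)) := by
  have himage : (fun t : ℝ => (c / t) ^ (1 / a)) '' Set.Ioi 0 = Set.Ioi 0 := by
    ext r
    constructor
    · rintro ⟨t, ht, rfl⟩
      exact Real.rpow_pos_of_pos (div_pos hc ht) _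
    · intro hr
      have hr : 0 < r := hr
      refine ⟨c * r ^ (-a), by have := Real.rpow_pos_of_pos hr (-a); exact mul_pos hc this, ?_⟩
      simp only
      rw [div_mul_cancel_left₀ hc.ne', ← Real.rpow_neg hr.le, neg_neg, ← Real.rpow_mul hr.le,
        mul_one_div_cancel ha.ne', Real.rpow_one]
  have hderiv : ∀ t ∈ Set.Ioi (0 : ℝ), HasDerivWithinAt (fun t : ℝ => (c / t) ^ (1 / a))
      (-c / t ^ 2 * (1 / a) * (c / t) ^ (1 / a - 1)) (Set.Ioi 0) t := fun t ht => by
    have ht : 0 < t := ht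
    have h1 : HasDerivAt (fun t : ℝ => c / t) (-c / t ^ 2) t := by
      have := (hasDerivAt_inv ht.ne').const_mul c
      convert! this using 1
      ring
    exact (h1.rpow_const (Or.inl (by positivity))).hasDerivWithinAt
  have h := lintegral_image_eq_lintegral_abs_deriv_mul measurableSet_Ioi hderiv
    (injOn_div_rpow hc ha) fun r => ENNReal.ofReal r * F r
  rw [himage] at h
  rw [h]
  refine setLIntegral_congr_fun measurableSet_Ioi fun t ht => ?_
  have ht : 0 < t := ht
  rw [← mul_assoc, ← ENNReal.ofReal_mul (abs_nonneg _)]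
  congr 2
  have hct : 0 < c / t := div_pos hc ht
  rw [show -c / t ^ 2 * (1 / a) * (c / t) ^ (1 / a - 1) =
      -(c / t ^ 2 * (1 / a) * (c / t) ^ (1 / a - 1)) by ring, abs_neg,
    abs_of_nonneg (by positivity)]
  have e1 : (c / t) ^ (2 / a + 1) = (c / t) ^ (1 / a - 1) * (c / t) ^ (1 / a) * (c / t) ^ 2 := by
    rw [← Real.rpow_add hct, ← Real.rpow_natCast (c / t) 2, ← Real.rpow_add hct]
    congr 1
    push_cast
    ring
  rw [e1]
  field_simp

section

variable {lam : ℝ} {p : ℝ → ℝ} {C α : LinkState → ℝ}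

lemma powerDensity_nonneg (hlam : 0 < lam) (hC : ∀ s, 0 < C s) (hα : ∀ s, 0 < α s)
    (hp01 : ∀ r, 0 ≤ r → 0 ≤ p r ∧ p r ≤ 1) (σ : LinkState) {t : ℝ} (ht : 0 < t) :
    0 ≤ powerDensity lam p C α σ t := by
  have h1 := hC σ
  have h2 := hα σ
  have := stateProb_nonneg hp01 σ (Real.rpow_nonneg (div_pos h1 ht).le (1 / α σ))
  have hpi := Real.pi_pos
  unfold powerDensity
  positivity

lemma measurable_powerDensity (hp : Measurable p) (σ : LinkState) :
    Measurable (powerDensity lam p C α σ) := by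
  have h1 : Measurable fun t : ℝ => C σ / t := measurable_const.div measurable_id
  unfold powerDensity
  exact (((measurable_stateProb hp σ).comp (h1.pow_const _)).const_mul _).mul (h1.pow_const _)

/-- The contribution of the links in state `σ` to the intensity measure of the link powers. -/
lemma lintegral_plane_state (hlam : 0 < lam) (hC : ∀ s, 0 < C s) (hα : ∀ s, 0 < α s)
    (hp : Measurable p) (σ : LinkState) {h : ℝ → ℝ≥0∞} (hh : Measurable h) :
    ENNReal.ofReal lam * ∫⁻ x : Plane, ENNReal.ofReal (stateProb p σ ‖x‖) *
        h (linkPower C α σ ‖x‖) =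
      ∫⁻ t in Set.Ioi (0 : ℝ), ENNReal.ofReal (powerDensity lam p C α σ t) * h t := by
  have h1 := hC σ
  have h2 := hα σ
  have hlp : Measurable fun r : ℝ => linkPower C α σ r :=
    (measurable_linkPower C α).comp (measurable_const.prodMk measurable_id)
  rw [lintegral_plane_norm (F := fun r => ENNReal.ofReal (stateProb p σ r) *
    h (linkPower C α σ r)) ((measurable_stateProb hp σ).ennreal_ofReal.mul (hh.comp hlp)),
    lintegral_radius_eq_lintegral_power h1 h2, ← mul_assoc,
    ← ENNReal.ofReal_mul hlam.le, ← lintegral_const_mul' _ _ ENNReal.ofReal_ne_top]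
  refine setLIntegral_congr_fun measurableSet_Ioi fun t ht => ?_
  have ht : 0 < t := ht
  have hpi := Real.pi_pos
  have hpos : 0 ≤ (C σ / t) ^ (2 / α σ + 1) := by positivity
  rw [linkPower, mul_div_rpow_rpow_neg h1 h2 ht, ← mul_assoc, ← mul_assoc,
    ← ENNReal.ofReal_mul (by positivity), ← ENNReal.ofReal_mul (by positivity)]
  congr 2
  unfold powerDensity
  field_simp

/-- The intensity measure of the link powers, obtained by mapping the marked intensity measure on
the plane to the half line. -/
lemma lintegral_plane_eq_thinnedPowerMeasure (hlam : 0 < lam) (hC : ∀ s, 0 < C s)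
    (hα : ∀ s, 0 < α s) (hp : Measurable p) (hp01 : ∀ r, 0 ≤ r → 0 ≤ p r ∧ p r ≤ 1)
    {h : ℝ → ℝ≥0∞} (hh : Measurable h) :
    ∫⁻ x : Plane, ∑ σ, ENNReal.ofReal (stateProb p σ ‖x‖) * h (linkPower C α σ ‖x‖)
        ∂(ENNReal.ofReal lam • (volume : Measure Plane)) =
      ∫⁻ t, h t ∂(thinnedPowerMeasure 1 lam p C α) := by
  have hlp : ∀ σ, Measurable fun x : Plane => linkPower C α σ ‖x‖ := fun σ =>
    (measurable_linkPower C α).comp (measurable_const.prodMk measurable_norm)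
  have hm := fun σ => measurable_powerDensity (lam := lam) (C := C) (α := α) hp σ
  have hterm : ∀ σ, Measurable fun x : Plane =>
      ENNReal.ofReal (stateProb p σ ‖x‖) * h (linkPower C α σ ‖x‖) := fun σ =>
    (((measurable_stateProb hp σ).comp measurable_norm).ennreal_ofReal).mul (hh.comp (hlp σ))
  have hdens : ∀ σ, Measurable fun t =>
      ENNReal.ofReal (powerDensity lam p C α σ t) * h t := fun σ => (hm σ).ennreal_ofReal.mul hh
  have htot : Measurable fun t => ENNReal.ofReal
      (1 * (powerDensity lam p C α .los t + powerDensity lam p C α .nlos t)) :=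
    (((hm _).add (hm _)).const_mul 1).ennreal_ofReal
  rw [lintegral_smul_measure, lintegral_finsetSum _ fun σ _ => hterm σ,
    smul_eq_mul, Finset.mul_sum]
  rw [Finset.sum_congr rfl fun σ _ => lintegral_plane_state hlam hC hα hp σ hh,
    ← lintegral_finsetSum _ fun σ _ => hdens σ, thinnedPowerMeasure,
    lintegral_withDensity_eq_lintegral_mul _ htot hh]
  refine setLIntegral_congr_fun measurableSet_Ioi fun t ht => ?_
  simp only [Pi.mul_apply]
  rw [sum_linkState, one_mul, ← add_mul, ENNReal.ofReal_add
    (powerDensity_nonneg hlam hC hα hp01 _ ht) (powerDensity_nonneg hlam hC hα hp01 _ ht)]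

lemma intensity_nonneg (hlam : 0 < lam) (hC : ∀ s, 0 < C s)
    (hp01 : ∀ r, 0 ≤ r → 0 ≤ p r ∧ p r ≤ 1) (σ : LinkState) {t : ℝ} (ht : 0 < t) :
    0 ≤ intensity lam p C α σ t := by
  have hpi := Real.pi_pos
  have h1 := div_pos (hC σ) ht
  refine mul_nonneg (by positivity) (intervalIntegral.integral_nonneg (Real.rpow_nonneg h1.le _)
    fun x hx => mul_nonneg (stateProb_nonneg hp01 _ hx.1) hx.1)

lemma ofReal_intensity (hlam : 0 < lam) (hC : ∀ s, 0 < C s)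
    (hα : ∀ s, 0 < α s) (hp : Measurable p) (hp01 : ∀ r, 0 ≤ r → 0 ≤ p r ∧ p r ≤ 1)
    (σ : LinkState) {t : ℝ} (ht : 0 < t) :
    ENNReal.ofReal (intensity lam p C α σ t) =
      ∫⁻ u in Set.Ici t, ENNReal.ofReal (powerDensity lam p C α σ u) := by
  have h1 := hC σ
  have h2 := hα σ
  have hpi := Real.pi_pos
  set R := (C σ / t) ^ (1 / α σ) with hR
  have hR0 : 0 ≤ R := Real.rpow_nonneg (div_pos h1 ht).le _
  have hint : IntegrableOn (fun x => stateProb p σ x * x) (Set.Ioc 0 R) := by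
    refine Measure.integrableOn_of_bounded (M := R) (by simp)
      ((measurable_stateProb hp σ).mul measurable_id).aestronglyMeasurable ?_
    filter_upwards [ae_restrict_mem measurableSet_Ioc] with x hx
    have e1 := stateProb_nonneg hp01 σ hx.1.le
    have e2 := stateProb_le_one hp01 σ hx.1.le
    rw [Real.norm_of_nonneg (mul_nonneg e1 hx.1.le)]
    nlinarith [hx.1, hx.2]
  have hmain : ∫⁻ x in Set.Ioc 0 R, ENNReal.ofReal (stateProb p σ x * x) =
      ∫⁻ r in Set.Ioi (0 : ℝ), ENNReal.ofReal r *
        (Set.Iic R).indicator (fun r => ENNReal.ofReal (stateProb p σ r)) r := by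
    rw [← Set.Ioi_inter_Iic, Set.inter_comm, ← Measure.restrict_restrict measurableSet_Iic,
      ← lintegral_indicator measurableSet_Iic]
    refine setLIntegral_congr_fun measurableSet_Ioi fun x hx => ?_
    have hx : 0 < x := hx
    by_cases hxR : x ∈ Set.Iic R
    · simp only [Set.indicator_of_mem hxR]
      rw [mul_comm, ENNReal.ofReal_mul hx.le]
    · simp only [Set.indicator_of_notMem hxR, mul_zero]
  rw [intensity, intervalIntegral.integral_of_le hR0, ENNReal.ofReal_mul (by positivity),
    ofReal_integral_eq_lintegral_ofReal hint (by
      filter_upwards [ae_restrict_mem measurableSet_Ioc] with x hx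
      exact mul_nonneg (stateProb_nonneg hp01 σ hx.1.le) hx.1.le), hmain,
    lintegral_radius_eq_lintegral_power h1 h2,
    ← lintegral_const_mul' _ _ ENNReal.ofReal_ne_top]
  have hsub : Set.Ici t = Set.Ici t ∩ Set.Ioi 0 :=
    (Set.inter_eq_left.2 fun u hu => ht.trans_le hu).symm
  rw [hsub, ← Measure.restrict_restrict measurableSet_Ici, ← lintegral_indicator measurableSet_Ici]
  refine setLIntegral_congr_fun measurableSet_Ioi fun u hu => ?_
  have hu : 0 < u := hu
  have hiff : (C σ / u) ^ (1 / α σ) ∈ Set.Iic R ↔ u ∈ Set.Ici t := by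
    rw [Set.mem_Iic, hR, Real.rpow_le_rpow_iff (by positivity) (by positivity) (by positivity),
      div_le_div_iff_of_pos_left h1 hu ht, Set.mem_Ici]
  by_cases hut : u ∈ Set.Ici t
  · simp only [Set.indicator_of_mem hut, Set.indicator_of_mem (hiff.2 hut)]
    rw [← ENNReal.ofReal_mul (by positivity), ← ENNReal.ofReal_mul (by positivity)]
    congr 1
    unfold powerDensity
    field_simp
  · simp only [Set.indicator_of_notMem hut, Set.indicator_of_notMem (mt hiff.1 hut), mul_zero]

/-- The mean number of BSs with link power at least `t`. -/
noncomputable def totalIntensity (lam : ℝ) (p : ℝ → ℝ) (C α : LinkState → ℝ) (t : ℝ) : ℝ :=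
  intensity lam p C α .los t + intensity lam p C α .nlos t

lemma totalIntensity_nonneg (hlam : 0 < lam) (hC : ∀ s, 0 < C s)
    (hp01 : ∀ r, 0 ≤ r → 0 ≤ p r ∧ p r ≤ 1) {t : ℝ} (ht : 0 < t) :
    0 ≤ totalIntensity lam p C α t :=
  add_nonneg (intensity_nonneg hlam hC hp01 _ ht) (intensity_nonneg hlam hC hp01 _ ht)

lemma thinnedPowerMeasure_apply {B : Set ℝ} (hB : MeasurableSet B) (hB0 : B ⊆ Set.Ioi 0) :
    thinnedPowerMeasure 1 lam p C α B =
      ∫⁻ t in B, ENNReal.ofReal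
        (powerDensity lam p C α .los t + powerDensity lam p C α .nlos t) := by
  rw [thinnedPowerMeasure, withDensity_apply _ hB, Measure.restrict_restrict hB,
    Set.inter_eq_left.2 hB0]
  simp

lemma thinnedPowerMeasure_Ici (hlam : 0 < lam) (hC : ∀ s, 0 < C s)
    (hα : ∀ s, 0 < α s) (hp : Measurable p) (hp01 : ∀ r, 0 ≤ r → 0 ≤ p r ∧ p r ≤ 1)
    {t : ℝ} (ht : 0 < t) :
    thinnedPowerMeasure 1 lam p C α (Set.Ici t) =
      ENNReal.ofReal (totalIntensity lam p C α t) := by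
  rw [thinnedPowerMeasure_apply measurableSet_Ici fun u hu => ht.trans_le hu, totalIntensity,
    ENNReal.ofReal_add (intensity_nonneg hlam hC hp01 _ ht) (intensity_nonneg hlam hC hp01 _ ht),
    ofReal_intensity hlam hC hα hp hp01 _ ht, ofReal_intensity hlam hC hα hp hp01 _ ht,
    ← lintegral_add_left (measurable_powerDensity hp _).ennreal_ofReal]
  refine setLIntegral_congr_fun measurableSet_Ici fun u hu => ?_
  have hu0 := ht.trans_le hu
  exact ENNReal.ofReal_add (powerDensity_nonneg hlam hC hα hp01 _ hu0)
    (powerDensity_nonneg hlam hC hα hp01 _ hu0)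

/-- The density of the link powers is bounded on `[ε, ∞)`. -/
lemma exists_powerDensity_le (hlam : 0 < lam) (hC : ∀ s, 0 < C s)
    (hα : ∀ s, 0 < α s) (hp01 : ∀ r, 0 ≤ r → 0 ≤ p r ∧ p r ≤ 1) {ε : ℝ} (hε : 0 < ε) :
    ∃ L : ℝ≥0, ∀ σ, ∀ t, ε ≤ t → powerDensity lam p C α σ t ≤ L := by
  have key : ∀ σ, ∀ t, ε ≤ t → powerDensity lam p C α σ t ≤
      2 * Real.pi * lam / (α σ * C σ) * (C σ / ε) ^ (2 / α σ + 1) := fun σ t ht => by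
    have h1 := hC σ
    have h2 := hα σ
    have hpi := Real.pi_pos
    have ht0 := hε.trans_le ht
    have e1 := stateProb_le_one hp01 σ (Real.rpow_nonneg (div_pos h1 ht0).le (1 / α σ))
    have e2 : (C σ / t) ^ (2 / α σ + 1) ≤ (C σ / ε) ^ (2 / α σ + 1) :=
      Real.rpow_le_rpow (by positivity) (div_le_div_of_nonneg_left h1.le hε ht) (by positivity)
    unfold powerDensity
    refine mul_le_mul ?_ e2 (by positivity) (by positivity)
    exact mul_le_of_le_one_right (by positivity) e1
  refine ⟨Real.toNNReal (∑ σ, 2 * Real.pi * lam / (α σ * C σ) * (C σ / ε) ^ (2 / α σ + 1)),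
    fun σ t ht => (key σ t ht).trans (le_trans ?_ (Real.le_coe_toNNReal _))⟩
  refine Finset.single_le_sum (f := fun σ =>
    2 * Real.pi * lam / (α σ * C σ) * (C σ / ε) ^ (2 / α σ + 1)) (fun τ _ => ?_)
    (Finset.mem_univ σ)
  have h1 := hC τ
  have h2 := hα τ
  have hpi := Real.pi_pos
  positivity

lemma thinnedPowerMeasure_le (hlam : 0 < lam) (hC : ∀ s, 0 < C s)
    (hα : ∀ s, 0 < α s) (hp01 : ∀ r, 0 ≤ r → 0 ≤ p r ∧ p r ≤ 1) {ε : ℝ} (hε : 0 < ε) :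
    ∃ L : ℝ≥0, ∀ a b, ε ≤ a →
      thinnedPowerMeasure 1 lam p C α (Set.Ico a b) ≤ L * ENNReal.ofReal (b - a) := by
  obtain ⟨L, hL⟩ := exists_powerDensity_le hlam hC hα hp01 hε
  refine ⟨L + L, fun a b ha => ?_⟩
  rw [thinnedPowerMeasure_apply measurableSet_Ico fun u hu => (hε.trans_le ha).trans_le hu.1]
  refine (setLIntegral_mono (g := fun _ => ((L + L : ℝ≥0) : ℝ≥0∞)) measurable_const
    fun u hu => ?_).trans ?_
  · refine ENNReal.ofReal_le_of_le_toReal ?_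
    have e1 := hL .los u (ha.trans hu.1)
    have e2 := hL .nlos u (ha.trans hu.1)
    rw [ENNReal.coe_toReal]
    push_cast
    linarith
  · rw [setLIntegral_const, Real.volume_Ico]

lemma intensity_sub (hlam : 0 < lam) (hC : ∀ s, 0 < C s)
    (hα : ∀ s, 0 < α s) (hp : Measurable p) (hp01 : ∀ r, 0 ≤ r → 0 ≤ p r ∧ p r ≤ 1)
    (σ : LinkState) {a b : ℝ} (ha : 0 < a) (hab : a ≤ b) :
    ENNReal.ofReal (intensity lam p C α σ a) =
      (∫⁻ u in Set.Ico a b, ENNReal.ofReal (powerDensity lam p C α σ u)) +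
        ENNReal.ofReal (intensity lam p C α σ b) := by
  rw [ofReal_intensity hlam hC hα hp hp01 _ ha,
    ofReal_intensity hlam hC hα hp hp01 _ (ha.trans_le hab), ← Set.Ico_union_Ici_eq_Ici hab,
    lintegral_union measurableSet_Ici]
  exact Set.disjoint_left.2 fun x hx hx' => (hx.2.trans_le hx').false

lemma antitoneOn_intensity (hlam : 0 < lam) (hC : ∀ s, 0 < C s)
    (hα : ∀ s, 0 < α s) (hp : Measurable p) (hp01 : ∀ r, 0 ≤ r → 0 ≤ p r ∧ p r ≤ 1)
    (σ : LinkState) : AntitoneOn (intensity lam p C α σ) (Set.Ioi 0) := fun a ha b _ hab => by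
  rw [← ENNReal.ofReal_le_ofReal_iff (intensity_nonneg hlam hC hp01 _ ha),
    intensity_sub hlam hC hα hp hp01 σ ha hab]
  exact le_add_self

lemma lipschitzOnWith_intensity (hlam : 0 < lam) (hC : ∀ s, 0 < C s)
    (hα : ∀ s, 0 < α s) (hp : Measurable p) (hp01 : ∀ r, 0 ≤ r → 0 ≤ p r ∧ p r ≤ 1)
    {ε : ℝ} (hε : 0 < ε) :
    ∃ L : ℝ≥0, ∀ σ, LipschitzOnWith L (intensity lam p C α σ) (Set.Ici ε) := by
  obtain ⟨L, hL⟩ := exists_powerDensity_le hlam hC hα hp01 hε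
  refine ⟨L, fun σ => LipschitzOnWith.of_le_add_mul L fun a ha b hb => ?_⟩
  have ha0 : 0 < a := hε.trans_le ha
  have hb0 : 0 < b := hε.trans_le hb
  rcases le_total a b with hab | hab
  · have hle : (∫⁻ u in Set.Ico a b, ENNReal.ofReal (powerDensity lam p C α σ u)) ≤
        ENNReal.ofReal (L * (b - a)) := by
      refine (setLIntegral_mono (g := fun _ => (L : ℝ≥0∞)) measurable_const
        fun u hu => ENNReal.ofReal_le_of_le_toReal (hL σ u (le_trans ha hu.1))).trans ?_
      rw [setLIntegral_const, Real.volume_Ico, ENNReal.ofReal_mul L.coe_nonneg,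
        ENNReal.ofReal_coe_nnreal]
    have hmain := intensity_sub hlam hC hα hp hp01 σ ha0 hab
    rw [← ENNReal.ofReal_le_ofReal_iff (add_nonneg (intensity_nonneg hlam hC hp01 _ hb0)
      (by positivity)), hmain, add_comm, ENNReal.ofReal_add (intensity_nonneg hlam hC hp01 _ hb0)
      (by positivity), Real.dist_eq, abs_sub_comm, abs_of_nonneg (sub_nonneg.2 hab)]
    gcongr
  · exact (antitoneOn_intensity hlam hC hα hp hp01 σ hb0 ha0 hab).trans
      (le_add_of_nonneg_right (by positivity))

/-! ### The density of the `K`-th strongest link power -/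

/-- The probability that a Poisson variable of mean `x` is less than `K`. -/
noncomputable def poissonCDF (K : ℕ) (x : ℝ) : ℝ :=
  ∑ j ∈ Finset.range K, Real.exp (-x) * x ^ j / (Nat.factorial j : ℝ)

lemma hasDerivAt_poissonCDF (n : ℕ) (x : ℝ) :
    HasDerivAt (poissonCDF (n + 1)) (-(Real.exp (-x) * x ^ n / (Nat.factorial n : ℝ))) x := by
  have hexp : HasDerivAt (fun x : ℝ => Real.exp (-x)) (-Real.exp (-x)) x := by
    simpa using (hasDerivAt_neg x).exp
  induction n with
  | zero =>
    have : poissonCDF (0 + 1) = fun x => Real.exp (-x) := by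
      ext y; simp [poissonCDF]
    rw [this]
    simpa using hexp
  | succ n ih =>
    have h1 : poissonCDF (n + 1 + 1) = fun y => poissonCDF (n + 1) y +
        Real.exp (-y) * y ^ (n + 1) / (Nat.factorial (n + 1) : ℝ) := by
      ext y
      rw [poissonCDF, Finset.sum_range_succ]
      rfl
    rw [h1]
    have h2 := ih.add ((hexp.mul (hasDerivAt_pow (n + 1) x)).div_const
      (Nat.factorial (n + 1) : ℝ))
    convert! h2 using 1
    have hn : (Nat.factorial n : ℝ) ≠ 0 := by positivity
    rw [Nat.factorial_succ]
    push_cast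
    field_simp
    ring

lemma lipschitzOnWith_poissonCDF (n : ℕ) :
    LipschitzOnWith 1 (poissonCDF (n + 1)) (Set.Ici 0) := by
  refine Convex.lipschitzOnWith_of_nnnorm_hasDerivWithin_le (convex_Ici 0)
    (fun x _ => (hasDerivAt_poissonCDF n x).hasDerivWithinAt) fun x hx => ?_
  have hx : 0 ≤ x := hx
  rw [← NNReal.coe_le_coe, coe_nnnorm, norm_neg, Real.norm_of_nonneg (by positivity),
    NNReal.coe_one, mul_div_assoc, Real.exp_neg, inv_mul_le_iff₀ (Real.exp_pos x), mul_one]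
  exact Real.pow_div_factorial_le_exp x hx n

lemma kthPowerPDF_nonneg (hlam : 0 < lam) (hC : ∀ s, 0 < C s)
    (hα : ∀ s, 0 < α s) (hp : Measurable p) (hp01 : ∀ r, 0 ≤ r → 0 ≤ p r ∧ p r ≤ 1) (K : ℕ)
    {t : ℝ} (ht : 0 < t) : 0 ≤ kthPowerPDF lam p C α K t := by
  have hd : ∀ σ, deriv (intensity lam p C α σ) t ≤ 0 := fun σ => by
    rw [← derivWithin_of_isOpen isOpen_Ioi (show t ∈ Set.Ioi 0 from ht)]
    exact (antitoneOn_intensity hlam hC hα hp hp01 σ).derivWithin_nonpos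
  have h1 := hd .los
  have h2 := hd .nlos
  have h3 := totalIntensity_nonneg (α := α) hlam hC hp01 ht
  unfold totalIntensity at h3
  unfold kthPowerPDF
  exact mul_nonneg (mul_nonneg (by positivity) (by linarith)) (by positivity)

lemma absolutelyContinuous_poissonCDF_totalIntensity (hlam : 0 < lam) (hC : ∀ s, 0 < C s)
    (hα : ∀ s, 0 < α s) (hp : Measurable p) (hp01 : ∀ r, 0 ≤ r → 0 ≤ p r ∧ p r ≤ 1) (n : ℕ)
    {a b : ℝ} (ha : 0 < a) (hab : a ≤ b) :
    AbsolutelyContinuousOnInterval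
      (fun t => poissonCDF (n + 1) (totalIntensity lam p C α t)) a b := by
  obtain ⟨L, hL⟩ := lipschitzOnWith_intensity hlam hC hα hp hp01 ha
  have hsub : Set.uIcc a b ⊆ Set.Ici a := by
    rw [Set.uIcc_of_le hab]
    exact Set.Icc_subset_Ici_self
  have hsum : LipschitzOnWith (L + L) (totalIntensity lam p C α) (Set.Ici a) :=
    (hL .los).add (hL .nlos)
  exact (((lipschitzOnWith_poissonCDF n).comp hsum fun t ht =>
    totalIntensity_nonneg hlam hC hp01 (ha.trans_le ht)).mono hsub).absolutelyContinuousOnInterval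

lemma lintegral_kthPowerPDF (hlam : 0 < lam) (hC : ∀ s, 0 < C s)
    (hα : ∀ s, 0 < α s) (hp : Measurable p) (hp01 : ∀ r, 0 ≤ r → 0 ≤ p r ∧ p r ≤ 1) {K : ℕ}
    (hK : 1 ≤ K) {a b : ℝ} (ha : 0 < a) (hab : a ≤ b) :
    ∫⁻ t in Set.Ico a b, ENNReal.ofReal (kthPowerPDF lam p C α K t) =
      ENNReal.ofReal (poissonCDF K (totalIntensity lam p C α b) -
        poissonCDF K (totalIntensity lam p C α a)) := by
  obtain ⟨n, rfl⟩ : ∃ n, K = n + 1 := ⟨K - 1, by omega⟩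
  obtain ⟨L, hL⟩ := lipschitzOnWith_intensity hlam hC hα hp hp01 ha
  have hac := absolutelyContinuous_poissonCDF_totalIntensity hlam hC hα hp hp01 n ha hab
  have hacσ : ∀ σ, AbsolutelyContinuousOnInterval (intensity lam p C α σ) a b := fun σ =>
    ((hL σ).mono (by
      rw [Set.uIcc_of_le hab]
      exact Set.Icc_subset_Ici_self)).absolutelyContinuousOnInterval
  -- the junk value of `deriv` is harmless: both intensities are differentiable almost everywhere
  have hderiv : ∀ᵐ t, t ∈ Set.Ioc a b →
      deriv (fun t => poissonCDF (n + 1) (totalIntensity lam p C α t)) t =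
        kthPowerPDF lam p C α (n + 1) t := by
    filter_upwards [(hacσ .los).ae_differentiableAt, (hacσ .nlos).ae_differentiableAt]
      with t h1 h2 ht
    have htu : t ∈ Set.uIcc a b := by
      rw [Set.uIcc_of_le hab]
      exact Set.Ioc_subset_Icc_self ht
    have h3 : HasDerivAt (totalIntensity lam p C α) _ t :=
      (h1 htu).hasDerivAt.add (h2 htu).hasDerivAt
    have h4 := ((hasDerivAt_poissonCDF n _).comp t h3).deriv
    refine Eq.trans h4 ?_
    rw [kthPowerPDF, ← Real.exp_add, totalIntensity, Nat.add_sub_cancel, neg_add]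
    ring
  have hFTC := hac.integral_deriv_eq_sub
  have hint := hac.intervalIntegrable_deriv
  rw [intervalIntegrable_iff_integrableOn_Ioc_of_le hab] at hint
  rw [intervalIntegral.integral_of_le hab] at hFTC
  rw [← hFTC, Measure.restrict_congr_set Ico_ae_eq_Ioc]
  have hcongr : (fun t => deriv (fun t => poissonCDF (n + 1) (totalIntensity lam p C α t)) t)
      =ᵐ[volume.restrict (Set.Ioc a b)] kthPowerPDF lam p C α (n + 1) :=
    (ae_restrict_iff' measurableSet_Ioc).2 hderiv
  rw [ofReal_integral_eq_lintegral_ofReal hint]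
  · exact lintegral_congr_ae (hcongr.symm.fun_comp ENNReal.ofReal)
  · filter_upwards [hcongr, ae_restrict_mem measurableSet_Ioc] with t h1 h2
    rw [h1]
    exact kthPowerPDF_nonneg hlam hC hα hp hp01 _ (ha.trans h2.1)

lemma aemeasurable_kthPowerPDF (hlam : 0 < lam) (hC : ∀ s, 0 < C s)
    (hα : ∀ s, 0 < α s) (hp : Measurable p) (hp01 : ∀ r, 0 ≤ r → 0 ≤ p r ∧ p r ≤ 1) (K : ℕ) :
    AEMeasurable (kthPowerPDF lam p C α K) (volume.restrict (Set.Ioi 0)) := by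
  have h1 : ∀ σ, AEMeasurable (intensity lam p C α σ) (volume.restrict (Set.Ioi 0)) := fun σ =>
    aemeasurable_restrict_of_antitoneOn measurableSet_Ioi
      (antitoneOn_intensity hlam hC hα hp hp01 σ)
  have h2 : ∀ σ, AEMeasurable (deriv (intensity lam p C α σ)) (volume.restrict (Set.Ioi 0)) :=
    fun σ => (measurable_deriv _).aemeasurable
  unfold kthPowerPDF
  exact (((h1 _).neg.exp.mul (h1 _).neg.exp).mul ((h2 _).neg.sub (h2 _))).mul
    ((((h1 _).add (h1 _)).pow_const _).div_const _)

lemma poissonCDF_mem_Icc (K : ℕ) {x : ℝ} (hx : 0 ≤ x) : poissonCDF K x ∈ Set.Icc (0 : ℝ) 1 := by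
  have h := hasSum_one_poissonMeasure ⟨x, hx⟩
  refine ⟨Finset.sum_nonneg fun j _ => by positivity, ?_⟩
  exact sum_le_hasSum _ (fun j _ => by positivity) h

lemma lintegral_kthPowerPDF_le_one (hlam : 0 < lam) (hC : ∀ s, 0 < C s)
    (hα : ∀ s, 0 < α s) (hp : Measurable p) (hp01 : ∀ r, 0 ≤ r → 0 ≤ p r ∧ p r ≤ 1) {K : ℕ}
    (hK : 1 ≤ K) :
    ∫⁻ t in Set.Ioi (0 : ℝ), ENNReal.ofReal (kthPowerPDF lam p C α K t) ≤ 1 := by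
  have hU : Set.Ioi (0 : ℝ) = ⋃ n : ℕ, Set.Ico ((2 : ℝ) ^ n)⁻¹ ((2 : ℝ) ^ n) := by
    ext t
    simp only [Set.mem_Ioi, Set.mem_iUnion, Set.mem_Ico]
    constructor
    · intro ht
      obtain ⟨n, hn⟩ := pow_unbounded_of_one_lt (max t t⁻¹) one_lt_two
      exact ⟨n, inv_le_of_inv_le₀ ht ((le_max_right _ _).trans hn.le),
        (le_max_left _ _).trans_lt hn⟩
    · rintro ⟨n, hn, -⟩
      exact (by positivity : (0 : ℝ) < ((2 : ℝ) ^ n)⁻¹).trans_le hn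
  have hmono : Monotone fun n : ℕ => Set.Ico ((2 : ℝ) ^ n)⁻¹ ((2 : ℝ) ^ n) := fun m n hmn =>
    Set.Ico_subset_Ico (inv_anti₀ (by positivity) (pow_le_pow_right₀ one_le_two hmn))
      (pow_le_pow_right₀ one_le_two hmn)
  rw [hU, setLIntegral_iUnion_of_directed _ hmono.directed_le]
  refine iSup_le fun n => ?_
  have h1 : (1 : ℝ) ≤ 2 ^ n := one_le_pow₀ one_le_two
  have h2 : (0 : ℝ) < (2 ^ n)⁻¹ := by positivity
  rw [lintegral_kthPowerPDF hlam hC hα hp hp01 hK h2 ((inv_le_one_of_one_le₀ h1).trans h1)]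
  refine ENNReal.ofReal_le_one.2 ?_
  have e1 := poissonCDF_mem_Icc K (totalIntensity_nonneg (α := α) hlam hC hp01 h2)
  have e2 := poissonCDF_mem_Icc K (totalIntensity_nonneg (α := α) hlam hC hp01
    (by positivity : (0 : ℝ) < 2 ^ n))
  linarith [e1.1, e2.2]

end

/-! ### Counts of a marked Poisson process -/

/-- Power series with coefficients in `[0, 1]` that agree on `[0, 1)` have equal coefficients. -/
lemma coeff_eq_of_tsum_pow_eq {a b : ℕ → ℝ≥0∞} (ha : ∀ k, a k ≤ 1) (hb : ∀ k, b k ≤ 1)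
    (h : ∀ z : ℝ≥0∞, z < 1 → ∑' k, z ^ k * a k = ∑' k, z ^ k * b k) : a = b := by
  have hat := fun k => ((ha k).trans_lt ENNReal.one_lt_top).ne
  have hbt := fun k => ((hb k).trans_lt ENNReal.one_lt_top).ne
  have hreal : ∀ (u : ℕ → ℝ≥0∞), (∀ k, u k ≤ 1) → ∀ z : ℝ, 0 ≤ z → z < 1 →
      Summable (fun k => z ^ k * (u k).toReal) ∧
      (∑' k, ENNReal.ofReal z ^ k * u k).toReal = ∑' k, z ^ k * (u k).toReal := by
    intro u hu z hz hz1
    have hterm : ∀ k, (ENNReal.ofReal z ^ k * u k).toReal = z ^ k * (u k).toReal := fun k => by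
      rw [ENNReal.toReal_mul, ENNReal.toReal_pow, ENNReal.toReal_ofReal hz]
    refine ⟨Summable.of_nonneg_of_le (fun k => by positivity) (fun k => ?_)
      (summable_geometric_of_lt_one hz hz1), ?_⟩
    · exact mul_le_of_le_one_right (by positivity)
        (ENNReal.toReal_le_of_le_ofReal zero_le_one (by simpa using hu k))
    · rw [ENNReal.tsum_toReal_eq fun k => ENNReal.mul_ne_top
        (ENNReal.pow_ne_top ENNReal.ofReal_ne_top) ((hu k).trans_lt ENNReal.one_lt_top).ne]
      exact tsum_congr hterm
  have hzero : ∀ z : ℝ, 0 ≤ z → z < 1 →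
      HasSum (fun k => z ^ k * ((a k).toReal - (b k).toReal)) 0 := fun z hz hz1 => by
    obtain ⟨sa, ea⟩ := hreal a ha z hz hz1
    obtain ⟨sb, eb⟩ := hreal b hb z hz hz1
    have := sa.hasSum.sub sb.hasSum
    rw [← ea, ← eb, h _ (ENNReal.ofReal_lt_one.2 hz1), sub_self] at this
    simpa only [mul_sub] using this
  have habs : ∀ k, |(a k).toReal - (b k).toReal| ≤ 1 := fun k => by
    have e1 := ENNReal.toReal_le_of_le_ofReal zero_le_one (by simpa using ha k)
    have e2 := ENNReal.toReal_le_of_le_ofReal zero_le_one (by simpa using hb k)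
    have e3 := (a k).toReal_nonneg
    have e4 := (b k).toReal_nonneg
    rw [abs_le]
    constructor <;> linarith
  have hc : ∀ k, (a k).toReal - (b k).toReal = 0 := by
    intro k
    induction k using Nat.strong_induction_on with
    | _ k ih =>
      -- the lowest coefficient is bounded by twice the argument
      have hle : ∀ z : ℝ, 0 < z → z ≤ 1 / 2 → |(a k).toReal - (b k).toReal| ≤ 2 * z := by
        intro z hz hz2
        have hz1 : z < 1 := by linarith
        have h1 := (hasSum_nat_add_iff' (k + 1)).2 (hzero z hz.le hz1)
        rw [Finset.sum_range_succ, Finset.sum_eq_zero (fun j hj => by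
          rw [ih j (Finset.mem_range.1 hj), mul_zero]), zero_add, zero_sub] at h1
        have hg : HasSum (fun j => z ^ (k + 1) * z ^ j) (z ^ (k + 1) * (1 - z)⁻¹) :=
          (hasSum_geometric_of_lt_one hz.le hz1).mul_left _
        have h2 := tsum_of_norm_bounded hg
          (f := fun j => z ^ (j + (k + 1)) * ((a (j + (k + 1))).toReal - (b (j + (k + 1))).toReal))
          (fun j => by
            rw [norm_mul, Real.norm_of_nonneg (by positivity), pow_add, mul_comm (z ^ j)]
            exact mul_le_of_le_one_right (by positivity) (habs _))
        rw [h1.tsum_eq, norm_neg, norm_mul, Real.norm_of_nonneg (by positivity), pow_succ,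
          mul_assoc] at h2
        refine (le_of_mul_le_mul_left h2 (by positivity)).trans ?_
        rw [mul_comm]
        refine mul_le_mul_of_nonneg_right ?_ hz.le
        rw [inv_le_comm₀ (by linarith) two_pos]
        linarith
      by_contra hne
      have hpos := abs_pos.2 hne
      have := hle (min (1 / 2) (|(a k).toReal - (b k).toReal| / 4)) (by positivity)
        (min_le_left _ _)
      have h3 := min_le_right (1 / 2) (|(a k).toReal - (b k).toReal| / 4)
      linarith
  funext k
  exact (ENNReal.toReal_eq_toReal_iff' (hat k) (hbt k)).1 (sub_eq_zero.1 (hc k))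

/-- The points `t 0, t 1, …` with the marks `W 0, W 1, …` have the generating functional of a
Poisson process with intensity `μ` and independent marks of law `ρ`. -/
structure HasPoissonFunctional {Ω : Type*} [MeasurableSpace Ω] (P : Measure Ω) (μ ρ : Measure ℝ)
    (t W : ℕ → Ω → ℝ) : Prop where
  measurable_point : ∀ i, Measurable (t i)
  measurable_mark : ∀ i, Measurable (W i)
  lintegral_iprod : ∀ Φ : ℝ → ℝ → ℝ≥0∞, Measurable (Function.uncurry Φ) → (∀ x w, Φ x w ≤ 1) →
    ∫⁻ ω, iprod (fun i => Φ (t i ω) (W i ω)) ∂P = expNeg (∫⁻ x, (1 - ∫⁻ w, Φ x w ∂ρ) ∂μ)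

lemma measurable_pointCount {Ω : Type*} [MeasurableSpace Ω] {t : ℕ → Ω → ℝ}
    (ht : ∀ i, Measurable (t i)) {B : Set ℝ} (hB : MeasurableSet B) :
    Measurable (pointCount t B) := by
  have hge : ∀ k : ℕ, MeasurableSet {ω | (k : ℕ∞) ≤ pointCount t B ω} := fun k => by
    have : {ω | (k : ℕ∞) ≤ pointCount t B ω} =
        ⋃ F ∈ {F : Finset ℕ | F.card = k}, ⋂ i ∈ F, t i ⁻¹' B := by
      ext ω
      simp only [Set.mem_ofPred_eq, Set.mem_iUnion, Set.mem_iInter, Set.mem_preimage, pointCount]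
      constructor
      · intro h
        obtain ⟨u, hu, huk⟩ := Set.exists_subset_encard_eq h
        have hfin : u.Finite := Set.finite_of_encard_eq_coe huk
        refine ⟨hfin.toFinset, ?_, fun i hi => hu (by simpa using hi)⟩
        rw [hfin.encard_eq_coe_toFinset_card] at huk
        exact_mod_cast huk
      · rintro ⟨F, hF, hFB⟩
        rw [← hF, ← Set.encard_coe_eq_coe_finsetCard]
        exact Set.encard_le_encard fun i hi => hFB i hi
    rw [this]
    exact MeasurableSet.biUnion (Set.to_countable _) fun F _ =>
      F.measurableSet_biInter fun i _ => ht i hB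
  refine measurable_to_countable' fun n => ?_
  induction n using ENat.recTopCoe with
  | top =>
    have : pointCount t B ⁻¹' {⊤} = ⋂ k : ℕ, {ω | (k : ℕ∞) ≤ pointCount t B ω} := by
      ext ω
      simp [ENat.eq_top_iff_forall_ge]
    rw [this]
    exact MeasurableSet.iInter hge
  | coe k =>
    have : pointCount t B ⁻¹' {(k : ℕ∞)} = {ω | (k : ℕ∞) ≤ pointCount t B ω} \
        {ω | ((k + 1 : ℕ) : ℕ∞) ≤ pointCount t B ω} := by
      ext ω
      simp only [Set.mem_preimage, Set.mem_singleton_iff, Set.mem_sdiff, Set.mem_ofPred_eq, not_le]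
      rw [Nat.cast_add, Nat.cast_one, ENat.lt_add_one_iff (ENat.natCast_ne_top k)]
      exact ⟨fun h => ⟨h.ge, h.le⟩, fun h => le_antisymm h.2 h.1⟩
    rw [this]
    exact (hge k).diff (hge (k + 1))

section Functional

variable {Ω : Type*} [MeasurableSpace Ω] {P : Measure Ω} {μ ρ : Measure ℝ} {t W : ℕ → Ω → ℝ}

/-- The number of points in `B` is a Poisson variable, independent of every product over the points
outside of `B`. -/
lemma HasPoissonFunctional.setLIntegral_count_eq [IsProbabilityMeasure P] [IsProbabilityMeasure ρ]
    (h : HasPoissonFunctional P μ ρ t W)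
    {B : Set ℝ} (hB : MeasurableSet B) (hμ : μ B ≠ ∞) {Φ : ℝ → ℝ → ℝ≥0∞}
    (hΦ : Measurable (Function.uncurry Φ)) (hΦ1 : ∀ x w, Φ x w ≤ 1)
    (hΦB : ∀ x ∈ B, ∀ w, Φ x w = 1) (k : ℕ) :
    ∫⁻ ω in {ω | pointCount t B ω = k}, iprod (fun i => Φ (t i ω) (W i ω)) ∂P =
      poissonMeasure (μ B).toNNReal {k} * ∫⁻ ω, iprod (fun i => Φ (t i ω) (W i ω)) ∂P := by
  classical
  set Z : Ω → ℝ≥0∞ := fun ω => iprod (fun i => Φ (t i ω) (W i ω)) with hZ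
  have hZm : Measurable Z := measurable_iprod fun i =>
    hΦ.comp ((h.measurable_point i).prodMk (h.measurable_mark i))
  have hNm := measurable_pointCount h.measurable_point hB
  have hNk : ∀ k : ℕ, MeasurableSet {ω | pointCount t B ω = k} := fun k =>
    hNm (measurableSet_singleton (k : ℕ∞))
  have hZ1 : ∫⁻ ω, Z ω ∂P ≤ 1 := (lintegral_mono fun ω => iprod_le_one).trans (by simp)
  have key := coeff_eq_of_tsum_pow_eq
    (a := fun k : ℕ => ∫⁻ ω in {ω | pointCount t B ω = k}, Z ω ∂P)
    (b := fun k : ℕ => poissonMeasure (μ B).toNNReal {k} * ∫⁻ ω, Z ω ∂P)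
    (fun k => (setLIntegral_le_lintegral _ _).trans hZ1)
    (fun k => mul_le_one' prob_le_one hZ1) ?_
  · exact congrFun key k
  intro z hz
  -- a further factor `z` for each point in `B`; if `B` contains infinitely many points, the product
  -- vanishes, so that only the finite counts contribute to the power series
  let Φ' : ℝ → ℝ → ℝ≥0∞ := fun x w => (if x ∈ B then z else 1) * Φ x w
  have hite : Measurable fun x : ℝ => if x ∈ B then z else 1 :=
    Measurable.ite hB measurable_const measurable_const
  have hΦ' : Measurable (Function.uncurry Φ') := (hite.comp measurable_fst).mul hΦ
  have hite1 : ∀ x : ℝ, (if x ∈ B then z else 1) ≤ 1 := fun x => by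
    split_ifs
    exacts [hz.le, le_rfl]
  have hprod : ∀ ω, iprod (fun i => Φ' (t i ω) (W i ω)) =
      ∑' k : ℕ, z ^ k * {ω | pointCount t B ω = k}.indicator Z ω := fun ω => by
    rw [show iprod (fun i => Φ' (t i ω) (W i ω)) =
      iprod (fun i => if i ∈ {i | t i ω ∈ B} then z else 1) * Z ω from
      iprod_mul (fun i => hite1 _) (fun i => hΦ1 _ _)]
    by_cases hfin : {i | t i ω ∈ B}.Finite
    · have hN : pointCount t B ω = ({i | t i ω ∈ B}.ncard : ℕ) :=
        hfin.cast_ncard_eq.symm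
      rw [iprod_ite_of_finite hfin hz.le, tsum_eq_single ({i | t i ω ∈ B}.ncard)]
      · rw [Set.indicator_of_mem (by exact hN)]
      · intro k hk
        rw [Set.indicator_of_notMem, mul_zero]
        intro (hk' : pointCount t B ω = k)
        rw [hN] at hk'
        exact hk (by exact_mod_cast hk'.symm)
    · rw [iprod_ite_of_infinite hfin hz, zero_mul]
      refine (ENNReal.tsum_eq_zero.2 fun k => ?_).symm
      rw [Set.indicator_of_notMem, mul_zero]
      intro (hk : pointCount t B ω = k)
      rw [pointCount, Set.Infinite.encard_eq hfin] at hk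
      exact ENat.top_ne_natCast k hk
  have hL : ∫⁻ ω, iprod (fun i => Φ' (t i ω) (W i ω)) ∂P =
      ∑' k : ℕ, z ^ k * ∫⁻ ω in {ω | pointCount t B ω = k}, Z ω ∂P := by
    rw [lintegral_congr hprod, lintegral_tsum fun k =>
      ((hZm.indicator (hNk k)).const_mul _).aemeasurable]
    refine tsum_congr fun k => ?_
    rw [lintegral_const_mul _ (hZm.indicator (hNk k)), lintegral_indicator (hNk k)]
  have hΦr : ∀ x, Measurable (Φ x) := fun x => hΦ.comp measurable_prodMk_left
  have hexp : ∫⁻ x, (1 - ∫⁻ w, Φ' x w ∂ρ) ∂μ =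
      (1 - z) * μ B + ∫⁻ x, (1 - ∫⁻ w, Φ x w ∂ρ) ∂μ := by
    rw [← setLIntegral_const, ← lintegral_indicator hB, ← lintegral_add_left
      (measurable_const.indicator hB)]
    refine lintegral_congr fun x => ?_
    by_cases hx : x ∈ B
    · simp [Φ', hx, hΦB x hx]
    · simp [Φ', hx]
  have hpois : (∑' k : ℕ, z ^ k * poissonMeasure (μ B).toNNReal {k}) =
      expNeg ((1 - z) * μ B) := by
    rw [← ENNReal.coe_toNNReal hμ, ← lintegral_pow_poissonMeasure _ hz.le, lintegral_countable']
    simp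
  rw [← hL, h.lintegral_iprod Φ' hΦ' fun x w => mul_le_one' (hite1 x) (hΦ1 x w), hexp, expNeg_add,
    ← hpois, ← h.lintegral_iprod Φ hΦ hΦ1, ← ENNReal.tsum_mul_right]
  exact tsum_congr fun k => mul_assoc _ _ _

lemma HasPoissonFunctional.setLIntegral_count_lt [IsProbabilityMeasure P] [IsProbabilityMeasure ρ]
    (h : HasPoissonFunctional P μ ρ t W)
    {B : Set ℝ} (hB : MeasurableSet B) (hμ : μ B ≠ ∞) {Φ : ℝ → ℝ → ℝ≥0∞}
    (hΦ : Measurable (Function.uncurry Φ)) (hΦ1 : ∀ x w, Φ x w ≤ 1)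
    (hΦB : ∀ x ∈ B, ∀ w, Φ x w = 1) (K : ℕ) :
    ∫⁻ ω in {ω | pointCount t B ω < K}, iprod (fun i => Φ (t i ω) (W i ω)) ∂P =
      ENNReal.ofReal (poissonCDF K (μ B).toReal) *
        ∫⁻ ω, iprod (fun i => Φ (t i ω) (W i ω)) ∂P := by
  have hNm := measurable_pointCount h.measurable_point hB
  have hset : {ω | pointCount t B ω < K} =
      ⋃ k ∈ Finset.range K, {ω | pointCount t B ω = (k : ℕ)} := by
    ext ω
    simp only [Set.mem_ofPred_eq, Set.mem_iUnion, Finset.mem_range, exists_prop]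
    constructor
    · intro hlt
      obtain ⟨k, hk⟩ := ENat.ne_top_iff_exists.1 (hlt.trans_le le_top).ne
      rw [← hk] at hlt ⊢
      exact ⟨k, by exact_mod_cast hlt, rfl⟩
    · rintro ⟨k, hk, he⟩
      rw [he]
      exact_mod_cast hk
  have hdisj : Set.PairwiseDisjoint (Finset.range K : Set ℕ)
      (fun k : ℕ => {ω | pointCount t B ω = (k : ℕ)}) := fun k _ l _ hkl =>
    Set.disjoint_left.2 fun ω (h1 : _ = _) (h2 : _ = _) => hkl (by
      rw [h1] at h2
      exact_mod_cast h2)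
  rw [hset, lintegral_biUnion_finset hdisj fun k _ => hNm (measurableSet_singleton (k : ℕ∞)),
    Finset.sum_congr rfl fun k _ => h.setLIntegral_count_eq hB hμ hΦ hΦ1 hΦB k, ← Finset.sum_mul,
    poissonCDF, ENNReal.ofReal_sum_of_nonneg fun j _ => by positivity]
  simp_rw [poissonMeasure_singleton]
  rfl

lemma HasPoissonFunctional.measure_count_lt [IsProbabilityMeasure P] [IsProbabilityMeasure ρ]
    (h : HasPoissonFunctional P μ ρ t W)
    {B : Set ℝ} (hB : MeasurableSet B) (hμ : μ B ≠ ∞) (K : ℕ) :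
    P {ω | pointCount t B ω < K} = ENNReal.ofReal (poissonCDF K (μ B).toReal) := by
  have := h.setLIntegral_count_lt hB hμ (Φ := fun _ _ => 1) measurable_const (fun _ _ => le_rfl)
    (fun _ _ _ => rfl) K
  simpa [iprod_one] using this

lemma HasPoissonFunctional.ae_pos [IsProbabilityMeasure P] [IsProbabilityMeasure ρ]
    (h : HasPoissonFunctional P μ ρ t W) (h0 : μ (Set.Iic 0) = 0) :
    ∀ᵐ ω ∂P, ∀ i, 0 < t i ω := by
  have h1 := h.measure_count_lt measurableSet_Iic (by rw [h0]; simp) 1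
  rw [h0] at h1
  simp only [ENNReal.toReal_zero, poissonCDF, Finset.sum_range_one] at h1
  have h2 : P {ω | pointCount t (Set.Iic 0) ω < (1 : ℕ)} = 1 := by
    rw [h1]; simp
  have hm : MeasurableSet {ω | pointCount t (Set.Iic 0) ω < (1 : ℕ)} :=
    measurable_pointCount h.measurable_point measurableSet_Iic
      (MeasurableSet.of_discrete (s := Set.Iio ((1 : ℕ) : ℕ∞)))
  have h3 : ∀ᵐ ω ∂P, pointCount t (Set.Iic 0) ω < (1 : ℕ) := (mem_ae_iff_prob_eq_one hm).2 h2
  filter_upwards [h3] with ω hω i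
  by_contra hi
  rw [Nat.cast_one, Order.lt_one_iff, pointCount, Set.encard_eq_zero] at hω
  have : i ∈ {i | t i ω ∈ Set.Iic 0} := not_lt.1 hi
  rw [hω] at this
  exact this

/-- Two or more points in a set of small mean are improbable to second order. -/
lemma HasPoissonFunctional.measure_two_le [IsProbabilityMeasure P] [IsProbabilityMeasure ρ]
    (h : HasPoissonFunctional P μ ρ t W) {B : Set ℝ} (hB : MeasurableSet B) (hμ : μ B ≠ ∞) :
    P {ω | 2 ≤ pointCount t B ω} ≤ μ B * μ B := by
  have hm : MeasurableSet {ω | pointCount t B ω < (2 : ℕ)} :=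
    measurable_pointCount h.measurable_point hB
      (MeasurableSet.of_discrete (s := Set.Iio ((2 : ℕ) : ℕ∞)))
  have hc : {ω | 2 ≤ pointCount t B ω} = {ω | pointCount t B ω < (2 : ℕ)}ᶜ := by
    ext ω
    exact (not_lt (a := pointCount t B ω) (b := 2)).symm
  rw [hc, prob_compl_eq_one_sub hm, h.measure_count_lt hB hμ, ← ENNReal.ofReal_one,
    ← ENNReal.ofReal_sub _ (poissonCDF_mem_Icc _ ENNReal.toReal_nonneg).1]
  set m := (μ B).toReal with hmdef
  have hm0 : 0 ≤ m := ENNReal.toReal_nonneg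
  rw [← ENNReal.ofReal_toReal hμ, ← ENNReal.ofReal_mul hm0]
  refine ENNReal.ofReal_le_ofReal ?_
  have e1 := Real.add_one_le_exp (-m)
  have e2 : poissonCDF 2 m = Real.exp (-m) * (1 + m) := by
    simp [poissonCDF, Finset.sum_range_succ]
    ring
  rw [e2]
  nlinarith

/-- No two points of the process coincide, if the intensity has a locally bounded density. -/
lemma HasPoissonFunctional.ae_ne [IsProbabilityMeasure P] [IsProbabilityMeasure ρ]
    (h : HasPoissonFunctional P μ ρ t W) (hfin : ∀ ε : ℝ, 0 < ε → μ (Set.Ici ε) ≠ ∞)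
    (hL : ∀ ε : ℝ, 0 < ε → ∃ L : ℝ≥0, ∀ a b, ε ≤ a →
      μ (Set.Ico a b) ≤ L * ENNReal.ofReal (b - a)) :
    ∀ᵐ ω ∂P, ∀ i j, i ≠ j → 0 < t i ω → t i ω ≠ t j ω := by
  have hε : ∀ ε : ℝ, 0 < ε → P {ω | ∃ i j, i ≠ j ∧ ε ≤ t i ω ∧ t i ω = t j ω} = 0 := by
    intro ε hε
    obtain ⟨L, hL⟩ := hL ε hε
    have hbound : ∀ δ : ℝ, 0 < δ → P {ω | ∃ i j, i ≠ j ∧ ε ≤ t i ω ∧ t i ω = t j ω} ≤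
        L * ENNReal.ofReal δ * μ (Set.Ici ε) := by
      intro δ hδ
      -- two coinciding points in `[ε, ∞)` share one of the cells `[c k, c (k + 1))`
      let c : ℕ → ℝ := fun k => ε + k * δ
      have hcε : ∀ k, ε ≤ c k := fun k => le_add_of_nonneg_right (by positivity)
      have hcmono : Monotone c := fun k l hkl => by
        simp only [c]
        gcongr
      have hcell : ∀ k, μ (Set.Ico (c k) (c (k + 1))) ≤ L * ENNReal.ofReal δ := fun k => by
        refine (hL _ _ (hcε k)).trans_eq ?_
        congr 2
        simp only [c]
        push_cast
        ring
      have hcellfin : ∀ k, μ (Set.Ico (c k) (c (k + 1))) ≠ ∞ := fun k =>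
        ((hcell k).trans_lt (ENNReal.mul_lt_top ENNReal.coe_lt_top ENNReal.ofReal_lt_top)).ne
      have hsub : {ω | ∃ i j, i ≠ j ∧ ε ≤ t i ω ∧ t i ω = t j ω} ⊆
          ⋃ k, {ω | 2 ≤ pointCount t (Set.Ico (c k) (c (k + 1))) ω} := by
        rintro ω ⟨i, j, hij, hi, ht⟩
        have h0 : 0 ≤ (t i ω - ε) / δ := div_nonneg (sub_nonneg.2 hi) hδ.le
        refine Set.mem_iUnion.2 ⟨⌊(t i ω - ε) / δ⌋₊, ?_⟩
        have hi' : t i ω ∈ Set.Ico (c ⌊(t i ω - ε) / δ⌋₊) (c (⌊(t i ω - ε) / δ⌋₊ + 1)) := by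
          have e1 := Nat.floor_le h0
          have e2 := Nat.lt_floor_add_one ((t i ω - ε) / δ)
          rw [le_div_iff₀ hδ] at e1
          rw [div_lt_iff₀ hδ] at e2
          constructor
          · simp only [c]; linarith
          · simp only [c]; push_cast; linarith
        have hpair : ({i, j} : Set ℕ) ⊆ {l | t l ω ∈
            Set.Ico (c ⌊(t i ω - ε) / δ⌋₊) (c (⌊(t i ω - ε) / δ⌋₊ + 1))} := by
          rintro l (rfl | rfl)
          · exact hi'
          · rw [Set.mem_ofPred_eq, ← ht]
            exact hi'
        exact (Set.encard_pair hij).symm.le.trans (Set.encard_le_encard hpair)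
      refine (measure_mono hsub).trans ((measure_iUnion_le _).trans ?_)
      refine (ENNReal.tsum_le_tsum fun k => (h.measure_two_le measurableSet_Ico (hcellfin k)).trans
        (mul_le_mul_left (hcell k) _)).trans ?_
      have hdisj : Pairwise (Function.onFun Disjoint fun k => Set.Ico (c k) (c (k + 1))) :=
        hcmono.pairwise_disjoint_on_Ico_succ
      rw [ENNReal.tsum_mul_left, ← measure_iUnion hdisj
        fun k => measurableSet_Ico]
      refine mul_le_mul_right (measure_mono (Set.iUnion_subset fun k x hx => ?_)) _
      exact (hcε k).trans hx.1
    have hlim : Tendsto (fun δ : ℝ => L * ENNReal.ofReal δ * μ (Set.Ici ε)) (𝓝[>] 0) (𝓝 0) := by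
      have h1 : Tendsto (fun δ : ℝ => ENNReal.ofReal δ) (𝓝[>] 0) (𝓝 0) := by
        have := (ENNReal.continuous_ofReal.tendsto (0 : ℝ)).mono_left
          (nhdsWithin_le_nhds (s := Set.Ioi 0))
        simpa using this
      have h2 := ENNReal.Tendsto.mul_const (ENNReal.Tendsto.const_mul h1
        (Or.inr (ENNReal.coe_ne_top (r := L)))) (Or.inr (hfin ε hε))
      simpa using h2
    refine le_antisymm (ge_of_tendsto hlim ?_) bot_le
    filter_upwards [self_mem_nhdsWithin] with δ hδ using hbound δ hδ
  have hall : ∀ᵐ ω ∂P, ∀ n : ℕ, ¬ ∃ i j, i ≠ j ∧ 1 / ((n : ℝ) + 1) ≤ t i ω ∧ t i ω = t j ω :=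
    ae_all_iff.2 fun n => by
      have := hε (1 / ((n : ℝ) + 1)) (by positivity)
      rw [ae_iff]
      simpa using this
  filter_upwards [hall] with ω hω i j hij hi heq
  obtain ⟨n, hn⟩ := exists_nat_one_div_lt hi
  exact hω n ⟨i, j, hij, hn.le, heq⟩

end Functional

/-! ### Dyadic discretization of the half line -/

/-- The `k`-th positive point of the dyadic grid of mesh `2⁻ⁿ`. -/
noncomputable def gridPoint (n k : ℕ) : ℝ := ((k : ℝ) + 1) / 2 ^ n

/-- The cell `[(k + 1) / 2ⁿ, (k + 2) / 2ⁿ)`. The cell at `0` is left out, so that the cells cover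
`[2⁻ⁿ, ∞)`. -/
def gridCell (n k : ℕ) : Set ℝ := Set.Ico (gridPoint n k) (gridPoint n (k + 1))

/-- The step function that on each cell has the value of `φ` in the left end point. -/
noncomputable def gridStep (φ : ℝ → ℝ≥0∞) (n : ℕ) (x : ℝ) : ℝ≥0∞ :=
  ∑' k, (gridCell n k).indicator (fun _ => φ (gridPoint n k)) x

lemma gridPoint_pos (n k : ℕ) : 0 < gridPoint n k := by
  unfold gridPoint
  positivity

lemma gridPoint_le_succ (n k : ℕ) : gridPoint n k ≤ gridPoint n (k + 1) := by
  unfold gridPoint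
  push_cast
  gcongr
  linarith

lemma measurableSet_gridCell (n k : ℕ) : MeasurableSet (gridCell n k) := measurableSet_Ico

lemma gridCell_subset (n k : ℕ) : gridCell n k ⊆ Set.Ioi 0 := fun _ hx =>
  (gridPoint_pos n k).trans_le hx.1

lemma eq_of_mem_gridCell {n k l : ℕ} {x : ℝ} (hk : x ∈ gridCell n k) (hl : x ∈ gridCell n l) :
    k = l := by
  have hmono : Monotone (gridPoint n) := monotone_nat_of_le_succ (gridPoint_le_succ n)
  by_contra hne
  exact Set.disjoint_left.1 (hmono.pairwise_disjoint_on_Ico_succ hne) hk hl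

lemma gridStep_of_mem {φ : ℝ → ℝ≥0∞} {n k : ℕ} {x : ℝ} (hk : x ∈ gridCell n k) :
    gridStep φ n x = φ (gridPoint n k) := by
  rw [gridStep, tsum_eq_single k fun l hl => Set.indicator_of_notMem
    (fun h => hl (eq_of_mem_gridCell h hk)) _, Set.indicator_of_mem hk]

lemma gridStep_le_one {φ : ℝ → ℝ≥0∞} (hφ : ∀ a, φ a ≤ 1) (n : ℕ) (x : ℝ) :
    gridStep φ n x ≤ 1 := by
  by_cases h : ∃ k, x ∈ gridCell n k
  · obtain ⟨k, hk⟩ := h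
    rw [gridStep_of_mem hk]
    exact hφ _
  · push Not at h
    rw [gridStep, ENNReal.tsum_eq_zero.2 fun k => Set.indicator_of_notMem (h k) _]
    exact zero_le_one

lemma exists_mem_gridCell {n : ℕ} {x : ℝ} (hx : ((2 : ℝ) ^ n)⁻¹ ≤ x) : ∃ k, x ∈ gridCell n k := by
  have h2 : (0 : ℝ) < 2 ^ n := by positivity
  have h1 : 1 ≤ x * 2 ^ n := by
    rw [inv_le_iff_one_le_mul₀ h2] at hx
    exact hx
  have h0 : 0 ≤ x * 2 ^ n - 1 := sub_nonneg.2 h1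
  refine ⟨⌊x * 2 ^ n - 1⌋₊, ?_, ?_⟩
  · rw [gridPoint, div_le_iff₀ h2]
    linarith [Nat.floor_le h0]
  · rw [gridPoint, lt_div_iff₀ h2]
    push_cast
    linarith [Nat.lt_floor_add_one (x * 2 ^ n - 1)]

lemma tendsto_gridStep {φ : ℝ → ℝ≥0∞} {x : ℝ} (hx : 0 < x)
    (hφ : Tendsto φ (𝓝[≤] x) (𝓝 (φ x))) :
    Tendsto (fun n => gridStep φ n x) atTop (𝓝 (φ x)) := by
  have hinv : Tendsto (fun n : ℕ => ((2 : ℝ) ^ n)⁻¹) atTop (𝓝 0) := by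
    simpa using tendsto_pow_atTop_nhds_zero_of_lt_one (r := (2 : ℝ)⁻¹) (by norm_num) (by norm_num)
  have hex : ∀ n : ℕ, ∃ y, y ≤ x ∧ x - ((2 : ℝ) ^ n)⁻¹ ≤ y ∧
      (((2 : ℝ) ^ n)⁻¹ ≤ x → gridStep φ n x = φ y) := fun n => by
    by_cases hn : ((2 : ℝ) ^ n)⁻¹ ≤ x
    · obtain ⟨k, hk⟩ := exists_mem_gridCell hn
      refine ⟨gridPoint n k, hk.1, ?_, fun _ => gridStep_of_mem hk⟩
      have h2 := hk.2
      have h3 : gridPoint n (k + 1) = gridPoint n k + ((2 : ℝ) ^ n)⁻¹ := by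
        unfold gridPoint
        push_cast
        ring
      linarith
    · exact ⟨x, le_rfl, by simp, fun h => absurd h hn⟩
  choose y hyx hy hstep using hex
  have hylim : Tendsto y atTop (𝓝[≤] x) := by
    refine tendsto_nhdsWithin_iff.2 ⟨?_, Eventually.of_forall hyx⟩
    refine tendsto_of_tendsto_of_tendsto_of_le_of_le ?_ tendsto_const_nhds hy hyx
    simpa using hinv.const_sub x
  refine (hφ.comp hylim).congr' ?_
  filter_upwards [hinv.eventually_le_const hx] with n hn
  exact (hstep n hn).symm

lemma tendsto_measure_Iio (m : Measure ℝ) (x : ℝ) :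
    Tendsto (fun a => m (Set.Iio a)) (𝓝[≤] x) (𝓝 (m (Set.Iio x))) := by
  refine tendsto_order.2 ⟨fun y hy => ?_, fun y hy => ?_⟩
  · obtain ⟨u, hu, hux, hlim⟩ := exists_seq_strictMono_tendsto x
    have hU : ⋃ n, Set.Iio (u n) = Set.Iio x := by
      ext z
      simp only [Set.mem_iUnion, Set.mem_Iio]
      exact ⟨fun ⟨n, hn⟩ => hn.trans (hux n), fun hz => (hlim.eventually (lt_mem_nhds hz)).exists⟩
    have hm := tendsto_measure_iUnion_atTop (μ := m) (s := fun n => Set.Iio (u n))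
      fun a b hab => Set.Iio_subset_Iio (hu.monotone hab)
    rw [hU] at hm
    obtain ⟨n, hn⟩ := (hm.eventually (lt_mem_nhds hy)).exists
    filter_upwards [mem_nhdsWithin_of_mem_nhds (lt_mem_nhds (hux n))] with a ha
    exact hn.trans_le (measure_mono (Set.Iio_subset_Iio (le_of_lt ha)))
  · filter_upwards [self_mem_nhdsWithin] with a ha
    exact (measure_mono (Set.Iio_subset_Iio ha)).trans_lt hy

lemma tendsto_gridStep_expNeg_measure (m : Measure ℝ) {x : ℝ} (hx : 0 < x) :
    Tendsto (fun n => gridStep (fun a => expNeg (m (Set.Iio a))) n x) atTop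
      (𝓝 (expNeg (m (Set.Iio x)))) :=
  tendsto_gridStep hx ((continuous_expNeg.tendsto _).comp (tendsto_measure_Iio m x))

lemma setLIntegral_gridStep_mul {φ : ℝ → ℝ≥0∞} (hφ : ∀ a, φ a ≤ 1) {f : ℝ → ℝ≥0∞}
    (hf : AEMeasurable f (volume.restrict (Set.Ioi 0))) (n : ℕ) :
    ∫⁻ x in Set.Ioi (0 : ℝ), gridStep φ n x * f x =
      ∑' k, φ (gridPoint n k) * ∫⁻ x in gridCell n k, f x := by
  have h1 : ∀ x, gridStep φ n x * f x =
      ∑' k, (gridCell n k).indicator (fun x => φ (gridPoint n k) * f x) x := fun x => by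
    rw [gridStep, ← ENNReal.tsum_mul_right]
    refine tsum_congr fun k => ?_
    by_cases hx : x ∈ gridCell n k
    · simp [hx]
    · simp [hx]
  rw [lintegral_congr h1, lintegral_tsum fun k =>
    (hf.const_mul _).indicator (measurableSet_gridCell n k)]
  refine tsum_congr fun k => ?_
  rw [lintegral_indicator (measurableSet_gridCell n k), Measure.restrict_restrict
    (measurableSet_gridCell n k), Set.inter_eq_left.2 (gridCell_subset n k),
    lintegral_const_mul' _ _ ((hφ _).trans_lt ENNReal.one_lt_top).ne]

lemma measurable_gridStep (φ : ℝ → ℝ≥0∞) (n : ℕ) : Measurable (gridStep φ n) :=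
  Measurable.tsum fun k => measurable_const.indicator (measurableSet_gridCell n k)

/-! ### The sum over all points except the `K` largest -/

/-- The threshold of a `K`-strongest set: the least value attained on it. Exactly the levels up to
the threshold are reached by at least `K` points. -/
lemma IsStrongestSet.exists_threshold {K : ℕ} (hK : 1 ≤ K) {t : ℕ → ℝ} {A : Finset ℕ}
    (hA : IsStrongestSet K t A) :
    ∃ i ∈ A, (∀ j ∈ A, t i ≤ t j) ∧ (∀ j ∉ A, t j ≤ t i) ∧
      ∀ a, {j | t j ∈ Set.Ici a}.encard < K ↔ t i < a := by
  have hne : A.Nonempty := Finset.card_pos.1 (by rw [hA.1]; exact hK)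
  obtain ⟨i, hi, hmin⟩ := A.exists_min_image t hne
  refine ⟨i, hi, hmin, fun j hj => hA.2 i hi j hj, fun a => ?_⟩
  constructor
  · intro hlt
    by_contra hle
    rw [not_lt] at hle
    have hsub : (A : Set ℕ) ⊆ {j | t j ∈ Set.Ici a} := fun j hj => hle.trans (hmin j hj)
    have := Set.encard_le_encard hsub
    rw [Set.encard_coe_eq_coe_finsetCard, hA.1] at this
    exact (this.trans_lt hlt).false
  · intro hlt
    have hsub : {j | t j ∈ Set.Ici a} ⊆ ((A.erase i : Finset ℕ) : Set ℕ) := fun j hj => by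
      have hj' : t i < t j := hlt.trans_le hj
      have hjA : j ∈ A := by
        by_contra hjA
        exact (hA.2 i hi j hjA).not_gt hj'
      exact Finset.mem_coe.2 (Finset.mem_erase.2 ⟨fun h => by rw [h] at hj'; exact hj'.false, hjA⟩)
    refine (Set.encard_le_encard hsub).trans_lt ?_
    rw [Set.encard_coe_eq_coe_finsetCard, Finset.card_erase_of_mem hi, hA.1]
    exact_mod_cast Nat.sub_lt hK one_pos

section Threshold

variable {Ω : Type*} [MeasurableSpace Ω] {P : Measure Ω} {μ ρ : Measure ℝ} {t W : ℕ → Ω → ℝ}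

/-- The event that the threshold lies in the `k`-th cell, in terms of the counts. -/
def thresholdEvent (t : ℕ → Ω → ℝ) (K n k : ℕ) : Set Ω :=
  {ω | pointCount t (Set.Ici (gridPoint n (k + 1))) ω < K} \
    {ω | pointCount t (Set.Ici (gridPoint n k)) ω < K}

/-- The sum of `v` over the points below the level `a`. -/
noncomputable def sumBelow (t W : ℕ → Ω → ℝ) (v : ℝ → ℝ → ℝ≥0∞) (a : ℝ) (ω : Ω) : ℝ≥0∞ :=
  ∑' i, (Set.Iio a).indicator (fun x => v x (W i ω)) (t i ω)

lemma HasPoissonFunctional.measurableSet_count_lt (h : HasPoissonFunctional P μ ρ t W) {B : Set ℝ}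
    (hB : MeasurableSet B) (K : ℕ) : MeasurableSet {ω | pointCount t B ω < K} :=
  measurable_pointCount h.measurable_point hB (MeasurableSet.of_discrete (s := Set.Iio (K : ℕ∞)))

lemma expNeg_sumBelow {Ω : Type*} (t W : ℕ → Ω → ℝ) (v : ℝ → ℝ → ℝ≥0∞) (a : ℝ) (ω : Ω) :
    expNeg (sumBelow t W v a ω) =
      iprod fun i => expNeg ((Set.Iio a).indicator (fun x => v x (W i ω)) (t i ω)) :=
  (iprod_expNeg _).symm

lemma measurable_uncurry_indicator_Iio {v : ℝ → ℝ → ℝ≥0∞} (hv : Measurable (Function.uncurry v))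
    (a : ℝ) :
    Measurable (Function.uncurry fun x w => expNeg ((Set.Iio a).indicator (fun x => v x w) x)) := by
  refine measurable_expNeg.comp ?_
  have : (Function.uncurry fun x w => (Set.Iio a).indicator (fun x => v x w) x) =
      (Prod.fst ⁻¹' Set.Iio a).indicator (Function.uncurry v) := by
    ext q
    by_cases hq : q.1 ∈ Set.Iio a
    · simp [Function.uncurry, Set.indicator, hq]
    · simp [Function.uncurry, Set.indicator]
  have hm := hv.indicator (measurable_fst (measurableSet_Iio (a := a)) :
    MeasurableSet (Prod.fst ⁻¹' Set.Iio a : Set (ℝ × ℝ)))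
  rw [← this] at hm
  exact hm

lemma HasPoissonFunctional.measurable_expNeg_sumBelow (h : HasPoissonFunctional P μ ρ t W)
    {v : ℝ → ℝ → ℝ≥0∞} (hv : Measurable (Function.uncurry v)) (a : ℝ) :
    Measurable fun ω => expNeg (sumBelow t W v a ω) := by
  simp_rw [expNeg_sumBelow]
  exact measurable_iprod fun i => (measurable_uncurry_indicator_Iio hv a).comp
    ((h.measurable_point i).prodMk (h.measurable_mark i))

lemma HasPoissonFunctional.lintegral_sumBelow [IsProbabilityMeasure ρ]
    (h : HasPoissonFunctional P μ ρ t W) {v : ℝ → ℝ → ℝ≥0∞}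
    (hv : Measurable (Function.uncurry v)) (a : ℝ) :
    ∫⁻ ω, expNeg (sumBelow t W v a ω) ∂P =
      expNeg (∫⁻ x in Set.Iio a, (1 - ∫⁻ w, expNeg (v x w) ∂ρ) ∂μ) := by
  simp_rw [expNeg_sumBelow]
  rw [h.lintegral_iprod (fun x w => expNeg ((Set.Iio a).indicator (fun x => v x w) x))
    (measurable_uncurry_indicator_Iio hv a) fun x w => expNeg_le_one _,
    ← lintegral_indicator measurableSet_Iio]
  congr 1
  refine lintegral_congr fun x => ?_
  by_cases hx : x ∈ Set.Iio a
  · simp only [Set.indicator_of_mem hx]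
  · simp only [Set.indicator_of_notMem hx, expNeg_zero, lintegral_const, measure_univ, mul_one,
      tsub_self]

lemma HasPoissonFunctional.setLIntegral_thresholdEvent [IsProbabilityMeasure P]
    [IsProbabilityMeasure ρ] (h : HasPoissonFunctional P μ ρ t W)
    (hfin : ∀ ε : ℝ, 0 < ε → μ (Set.Ici ε) ≠ ∞) {v : ℝ → ℝ → ℝ≥0∞}
    (hv : Measurable (Function.uncurry v)) (K n k : ℕ) :
    ∫⁻ ω in thresholdEvent t K n k, expNeg (sumBelow t W v (gridPoint n k) ω) ∂P =
      (∫⁻ ω, expNeg (sumBelow t W v (gridPoint n k) ω) ∂P) *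
        ENNReal.ofReal (poissonCDF K (μ (Set.Ici (gridPoint n (k + 1)))).toReal -
          poissonCDF K (μ (Set.Ici (gridPoint n k))).toReal) := by
  have hcount : ∀ b, gridPoint n k ≤ b →
      ∫⁻ ω in {ω | pointCount t (Set.Ici b) ω < K},
        expNeg (sumBelow t W v (gridPoint n k) ω) ∂P =
      ENNReal.ofReal (poissonCDF K (μ (Set.Ici b)).toReal) *
        ∫⁻ ω, expNeg (sumBelow t W v (gridPoint n k) ω) ∂P := fun b hb => by
    simp_rw [expNeg_sumBelow]
    refine h.setLIntegral_count_lt measurableSet_Ici (hfin b ((gridPoint_pos n k).trans_le hb))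
      (Φ := fun x w => expNeg ((Set.Iio (gridPoint n k)).indicator (fun x => v x w) x))
      (measurable_uncurry_indicator_Iio hv _) (fun x w => expNeg_le_one _) (fun x hx w => ?_) K
    rw [Set.indicator_of_notMem fun hx' => (hx'.trans_le (hb.trans hx)).false, expNeg_zero]
  have hsub : {ω | pointCount t (Set.Ici (gridPoint n k)) ω < K} ⊆
      {ω | pointCount t (Set.Ici (gridPoint n (k + 1))) ω < K} := fun ω hω =>
    lt_of_le_of_lt (Set.encard_le_encard fun i hi => (gridPoint_le_succ n k).trans hi) hω
  have hm := h.measurableSet_count_lt (measurableSet_Ici (a := gridPoint n k)) K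
  have hle1 : ∫⁻ ω, expNeg (sumBelow t W v (gridPoint n k) ω) ∂P ≤ 1 :=
    (lintegral_mono fun ω => expNeg_le_one _).trans (by simp)
  have hne := (hle1.trans_lt ENNReal.one_lt_top).ne
  have hadd := lintegral_inter_add_sdiff (μ := P)
    (fun ω => expNeg (sumBelow t W v (gridPoint n k) ω))
    {ω | pointCount t (Set.Ici (gridPoint n (k + 1))) ω < K} hm
  rw [Set.inter_eq_right.2 hsub, hcount _ le_rfl, hcount _ (gridPoint_le_succ n k)] at hadd
  rw [ENNReal.ofReal_sub _ (poissonCDF_mem_Icc _ ENNReal.toReal_nonneg).1, ENNReal.mul_sub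
    fun _ _ => hne, thresholdEvent, mul_comm, mul_comm (lintegral _ _)]
  refine ENNReal.eq_sub_of_add_eq (ENNReal.mul_ne_top ENNReal.ofReal_ne_top hne) ?_
  rw [add_comm]
  exact hadd

/-- The Laplace functional of the sum over all points of a marked Poisson process except the `K`
largest ones: conditionally on the `K`-th largest value `T`, the points below `T` form a Poisson
process. Here `f` is the density of `T`. -/
theorem HasPoissonFunctional.lintegral_sum_compl [IsProbabilityMeasure P]
    [IsProbabilityMeasure ρ] (h : HasPoissonFunctional P μ ρ t W)
    (h0 : μ (Set.Iic 0) = 0) (hfin : ∀ ε : ℝ, 0 < ε → μ (Set.Ici ε) ≠ ∞)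
    (hL : ∀ ε : ℝ, 0 < ε → ∃ L : ℝ≥0, ∀ a b, ε ≤ a →
      μ (Set.Ico a b) ≤ L * ENNReal.ofReal (b - a))
    {v : ℝ → ℝ → ℝ≥0∞} (hv : Measurable (Function.uncurry v)) {K : ℕ} (hK : 1 ≤ K)
    {f : ℝ → ℝ≥0∞} (hf : AEMeasurable f (volume.restrict (Set.Ioi 0)))
    (hf1 : ∫⁻ x in Set.Ioi (0 : ℝ), f x ≠ ∞)
    (hfdens : ∀ a b : ℝ, 0 < a → a ≤ b → ∫⁻ x in Set.Ico a b, f x =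
      ENNReal.ofReal (poissonCDF K (μ (Set.Ici b)).toReal - poissonCDF K (μ (Set.Ici a)).toReal))
    {A : Ω → Finset ℕ} (hA : ∀ᵐ ω ∂P, IsStrongestSet K (fun i => t i ω) (A ω)) :
    ∫⁻ ω, expNeg (∑' i : {i : ℕ // i ∉ A ω}, v (t i ω) (W i ω)) ∂P =
      ∫⁻ x in Set.Ioi (0 : ℝ),
        expNeg (∫⁻ u in Set.Iio x, (1 - ∫⁻ w, expNeg (v u w) ∂ρ) ∂μ) * f x := by
  set Ψ : ℝ → ℝ≥0∞ := fun a => expNeg (∫⁻ u in Set.Iio a, (1 - ∫⁻ w, expNeg (v u w) ∂ρ) ∂μ)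
    with hΨ
  have hΨ1 : ∀ a, Ψ a ≤ 1 := fun a => expNeg_le_one _
  have hE : ∀ n k, MeasurableSet (thresholdEvent t K n k) := fun n k =>
    (h.measurableSet_count_lt measurableSet_Ici K).diff
      (h.measurableSet_count_lt measurableSet_Ici K)
  let X : ℕ → Ω → ℝ≥0∞ := fun n ω => ∑' k, (thresholdEvent t K n k).indicator
    (fun ω => expNeg (sumBelow t W v (gridPoint n k) ω)) ω
  have hXm : ∀ n, Measurable (X n) := fun n => Measurable.tsum fun k =>
    (h.measurable_expNeg_sumBelow hv _).indicator (hE n k)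
  have hXint : ∀ n, ∫⁻ ω, X n ω ∂P = ∫⁻ x in Set.Ioi (0 : ℝ), gridStep Ψ n x * f x := fun n => by
    rw [setLIntegral_gridStep_mul hΨ1 hf, lintegral_tsum fun k =>
      ((h.measurable_expNeg_sumBelow hv _).indicator (hE n k)).aemeasurable]
    refine tsum_congr fun k => ?_
    rw [lintegral_indicator (hE n k), h.setLIntegral_thresholdEvent hfin hv,
      h.lintegral_sumBelow hv, gridCell, hfdens _ _ (gridPoint_pos n k) (gridPoint_le_succ n k)]
  -- the right-hand side
  have hR : Tendsto (fun n => ∫⁻ x in Set.Ioi (0 : ℝ), gridStep Ψ n x * f x) atTop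
      (𝓝 (∫⁻ x in Set.Ioi (0 : ℝ), Ψ x * f x)) := by
    refine tendsto_lintegral_of_dominated_convergence' f
      (fun n => (measurable_gridStep Ψ n).aemeasurable.mul hf)
      (fun n => Eventually.of_forall fun x => mul_le_of_le_one_left' (gridStep_le_one hΨ1 n x))
      hf1 ?_
    filter_upwards [ae_restrict_mem measurableSet_Ioi, ae_lt_top' hf hf1] with x hx hfx
    refine ENNReal.Tendsto.mul_const ?_ (Or.inr hfx.ne)
    have hw : ∀ a, (μ.withDensity fun u => 1 - ∫⁻ w, expNeg (v u w) ∂ρ) (Set.Iio a) =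
        ∫⁻ u in Set.Iio a, (1 - ∫⁻ w, expNeg (v u w) ∂ρ) ∂μ := fun a =>
      withDensity_apply _ measurableSet_Iio
    have := tendsto_gridStep_expNeg_measure
      (μ.withDensity fun u => 1 - ∫⁻ w, expNeg (v u w) ∂ρ) hx
    simp_rw [hw] at this
    exact this
  -- the left-hand side: almost surely, `X n` is a step function evaluated at the threshold
  have hpt : ∀ᵐ ω ∂P, (∀ n, X n ω ≤ 1) ∧ Tendsto (fun n => X n ω) atTop
      (𝓝 (expNeg (∑' i : {i : ℕ // i ∉ A ω}, v (t i ω) (W i ω)))) := by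
    filter_upwards [hA, h.ae_pos h0, h.ae_ne hfin hL] with ω hAω hpos hne
    obtain ⟨i, hi, hmin, hmax, hcount⟩ := hAω.exists_threshold hK
    let m : Measure ℝ := Measure.sum fun j => v (t j ω) (W j ω) • Measure.dirac (t j ω)
    have hm : ∀ a, m (Set.Iio a) = sumBelow t W v a ω := fun a => by
      rw [Measure.sum_apply _ measurableSet_Iio, sumBelow]
      refine tsum_congr fun j => ?_
      rw [Measure.smul_apply, Measure.dirac_apply' _ measurableSet_Iio, smul_eq_mul]
      by_cases hj : t j ω ∈ Set.Iio a
      · simp [Set.indicator_of_mem hj]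
      · simp [Set.indicator_of_notMem hj]
    have hmem : ∀ n k, ω ∈ thresholdEvent t K n k ↔ t i ω ∈ gridCell n k := fun n k => by
      rw [thresholdEvent, Set.mem_sdiff, Set.mem_ofPred_eq, Set.mem_ofPred_eq, pointCount,
        pointCount, hcount, hcount, not_lt, gridCell, Set.mem_Ico, and_comm]
    have hX : ∀ n, X n ω = gridStep (fun a => expNeg (m (Set.Iio a))) n (t i ω) := fun n => by
      refine tsum_congr fun k => ?_
      by_cases hk : t i ω ∈ gridCell n k
      · rw [Set.indicator_of_mem ((hmem n k).2 hk), Set.indicator_of_mem hk, ← hm]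
      · rw [Set.indicator_of_notMem (mt (hmem n k).1 hk), Set.indicator_of_notMem hk]
    have hlim : m (Set.Iio (t i ω)) = ∑' j : {j : ℕ // j ∉ A ω}, v (t j ω) (W j ω) := by
      rw [hm, sumBelow]
      refine Eq.trans (tsum_congr fun j => ?_)
        (tsum_subtype {j | j ∉ A ω} fun j => v (t j ω) (W j ω)).symm
      by_cases hj : j ∈ A ω
      · rw [Set.indicator_of_notMem (s := Set.Iio _) fun hlt => (hmin j hj).not_gt hlt,
          Set.indicator_of_notMem (s := {j | j ∉ A ω}) (by simpa using hj)]
      · have hlt : t j ω < t i ω := lt_of_le_of_ne (hmax j hj) fun heq =>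
          hne i j (fun hij => hj (hij ▸ hi)) (hpos i) heq.symm
        rw [Set.indicator_of_mem (s := Set.Iio _) hlt,
          Set.indicator_of_mem (s := {j | j ∉ A ω}) hj]
    refine ⟨fun n => (hX n).trans_le (gridStep_le_one (fun a => expNeg_le_one _) n _), ?_⟩
    rw [← hlim]
    exact (tendsto_gridStep_expNeg_measure m (hpos i)).congr fun n => (hX n).symm
  have hLt : Tendsto (fun n => ∫⁻ ω, X n ω ∂P) atTop
      (𝓝 (∫⁻ ω, expNeg (∑' i : {i : ℕ // i ∉ A ω}, v (t i ω) (W i ω)) ∂P)) :=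
    tendsto_lintegral_of_dominated_convergence (fun _ => 1) hXm
      (fun n => hpt.mono fun ω hω => hω.1 n) (by simp) (hpt.mono fun ω hω => hω.2)
  simp_rw [hXint] at hLt
  exact tendsto_nhds_unique hLt hR

end Threshold

/-! ### The Laplace transform of the interference -/

lemma lintegral_exp_expMeasure {c : ℝ} (hc : 0 ≤ c) :
    ∫⁻ x, expNeg (ENNReal.ofReal (c * x)) ∂(expMeasure 1) = ENNReal.ofReal (1 / (1 + c)) := by
  have hm : Measurable fun x : ℝ => expNeg (ENNReal.ofReal (c * x)) :=
    measurable_expNeg.comp (by fun_prop)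
  have hpdf : Measurable (exponentialPDF 1) := (measurable_exponentialPDFReal 1).ennreal_ofReal
  have h1 : expMeasure 1 = volume.withDensity (exponentialPDF 1) := rfl
  have h2 : ∀ x, (exponentialPDF 1 * fun x => expNeg (ENNReal.ofReal (c * x))) x =
      ENNReal.ofReal (1 / (1 + c)) * exponentialPDF (1 + c) x := fun x => by
    rw [Pi.mul_apply]
    rcases lt_or_ge x 0 with hx | hx
    · rw [exponentialPDF_of_neg hx, exponentialPDF_of_neg hx, zero_mul, mul_zero]
    · rw [exponentialPDF_of_nonneg hx, exponentialPDF_of_nonneg hx,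
        expNeg_ofReal (mul_nonneg hc hx), ← ENNReal.ofReal_mul (by positivity),
        ← ENNReal.ofReal_mul (by positivity)]
      congr 1
      rw [one_mul, one_mul, ← Real.exp_add, ← mul_assoc, one_div_mul_cancel (by linarith), one_mul]
      congr 1
      ring
  rw [h1, lintegral_withDensity_eq_lintegral_mul _ hpdf hm, lintegral_congr h2,
    lintegral_const_mul' _ _ ENNReal.ofReal_ne_top,
    lintegral_exponentialPDF_eq_one (by linarith), mul_one]

lemma isProbabilityMeasure_fadedGainLaw {N : ℕ} (hN : 1 ≤ N) (G g : ℝ) :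
    IsProbabilityMeasure (fadedGainLaw N G g) := by
  have : IsProbabilityMeasure (expMeasure 1) := isProbabilityMeasure_expMeasure one_pos
  have hN' : (1 : ℝ) ≤ N := by exact_mod_cast hN
  have h := lintegral_fadedGainLaw N G g (h := fun _ => 1) measurable_const
  simp only [lintegral_const, measure_univ, mul_one, one_mul] at h
  refine ⟨h.trans ?_⟩
  rw [← ENNReal.ofReal_add (by positivity) (sub_nonneg.2 (by
    rw [div_le_one (by linarith)]; exact hN'))]
  simp

/-- The mean of `1 - exp (-s Pow w u)` over the gain and fading `w` of a link of power `u`: the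
exponential law of the fading power turns it into a rational function for each of the two lobes. -/
lemma one_sub_lintegral_fadedGainLaw {N : ℕ} (hN : 1 ≤ N) {Pow G g s u : ℝ} (hPow : 0 < Pow)
    (hG : 0 ≤ G) (hg : 0 ≤ g) (hs : 0 ≤ s) (hu : 0 < u) :
    1 - ∫⁻ w, expNeg (ENNReal.ofReal s * ENNReal.ofReal (Pow * w * u)) ∂(fadedGainLaw N G g) =
      ENNReal.ofReal (1 / (N : ℝ)) *
        ENNReal.ofReal (s * Pow * G * u / (1 + s * Pow * G * u)) +
      ENNReal.ofReal (1 - 1 / (N : ℝ)) *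
        ENNReal.ofReal (s * Pow * g * u / (1 + s * Pow * g * u)) := by
  have hN' : (1 : ℝ) ≤ N := by exact_mod_cast hN
  have hq0 : 0 ≤ 1 / (N : ℝ) := by positivity
  have hq1 : 0 ≤ 1 - 1 / (N : ℝ) := sub_nonneg.2 (by rw [div_le_one (by linarith)]; exact hN')
  have hlobe : ∀ γ : ℝ, 0 ≤ γ →
      ∫⁻ x, expNeg (ENNReal.ofReal s * ENNReal.ofReal (Pow * (γ * x) * u)) ∂(expMeasure 1) =
        ENNReal.ofReal (1 / (1 + s * Pow * γ * u)) := fun γ hγ => by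
    rw [← lintegral_exp_expMeasure (by positivity)]
    refine lintegral_congr fun x => ?_
    rw [← ENNReal.ofReal_mul hs]
    congr 2
    ring
  have hm : Measurable fun w : ℝ => expNeg (ENNReal.ofReal s * ENNReal.ofReal (Pow * w * u)) :=
    measurable_expNeg.comp (by fun_prop)
  rw [lintegral_fadedGainLaw N G g hm, hlobe G hG, hlobe g hg]
  have c1 : 0 ≤ s * Pow * G * u := by positivity
  have c2 : 0 ≤ s * Pow * g * u := by positivity
  rw [← ENNReal.ofReal_mul hq0, ← ENNReal.ofReal_mul hq1, ← ENNReal.ofReal_mul hq0,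
    ← ENNReal.ofReal_mul hq1, ← ENNReal.ofReal_add (by positivity) (by positivity),
    ← ENNReal.ofReal_add (by positivity) (by positivity), ← ENNReal.ofReal_one,
    ← ENNReal.ofReal_sub _ (by positivity)]
  congr 1
  have d1 : 1 + s * Pow * G * u ≠ 0 := by positivity
  have d2 : 1 + s * Pow * g * u ≠ 0 := by positivity
  have e1 : s * Pow * G * u / (1 + s * Pow * G * u) = 1 - 1 / (1 + s * Pow * G * u) := by
    field_simp
    ring
  have e2 : s * Pow * g * u / (1 + s * Pow * g * u) = 1 - 1 / (1 + s * Pow * g * u) := by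
    field_simp
    ring
  rw [e1, e2]
  ring

section

variable {lam : ℝ} {p : ℝ → ℝ} {C α : LinkState → ℝ}

lemma thinnedPowerMeasure_eq_smul (hp : Measurable p) {c : ℝ} (hc : 0 ≤ c) :
    thinnedPowerMeasure c lam p C α = ENNReal.ofReal c • thinnedPowerMeasure 1 lam p C α := by
  have hm : Measurable fun t => ENNReal.ofReal
      (1 * (powerDensity lam p C α .los t + powerDensity lam p C α .nlos t)) :=
    (((measurable_powerDensity hp _).add (measurable_powerDensity hp _)).const_mul 1).ennreal_ofReal
  rw [thinnedPowerMeasure, thinnedPowerMeasure, ← withDensity_smul _ hm]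
  congr 1
  funext t
  rw [ENNReal.ofReal_mul hc, Pi.smul_apply, one_mul, smul_eq_mul]

lemma thinnedPowerMeasure_Iic : thinnedPowerMeasure 1 lam p C α (Set.Iic 0) = 0 := by
  refine withDensity_absolutelyContinuous _ _ ?_
  rw [Measure.restrict_apply measurableSet_Iic, Set.Iic_inter_Ioi, Set.Ioc_self, measure_empty]

/-- The exponent of the Laplace transform, as the integral of the mean loss per link over the
intensity measure of the link powers. -/
lemma lintegral_Iio_eq_lobeExponent {N : ℕ} (hN : 1 ≤ N) {Pow G g s : ℝ} (hPow : 0 < Pow)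
    (hG : 0 ≤ G) (hg : 0 ≤ g) (hs : 0 ≤ s) (hp : Measurable p) (T : ℝ) :
    ∫⁻ u in Set.Iio T, (1 - ∫⁻ w, expNeg (ENNReal.ofReal s * ENNReal.ofReal (Pow * w * u))
        ∂(fadedGainLaw N G g)) ∂(thinnedPowerMeasure 1 lam p C α) =
      lobeExponent (thinnedPowerMeasure (1 / (N : ℝ)) lam p C α) s Pow G T +
        lobeExponent (thinnedPowerMeasure (1 - 1 / (N : ℝ)) lam p C α) s Pow g T := by
  have hN' : (1 : ℝ) ≤ N := by exact_mod_cast hN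
  have hq0 : 0 ≤ 1 / (N : ℝ) := by positivity
  have hq1 : 0 ≤ 1 - 1 / (N : ℝ) := sub_nonneg.2 (by rw [div_le_one (by linarith)]; exact hN')
  have hae : (Set.Iio T : Set ℝ) =ᵐ[thinnedPowerMeasure 1 lam p C α] Set.Ioo 0 T := by
    have h0 : ∀ᵐ u ∂(thinnedPowerMeasure 1 lam p C α), u ∉ Set.Iic (0 : ℝ) :=
      measure_eq_zero_iff_ae_notMem.1 thinnedPowerMeasure_Iic
    filter_upwards [h0] with u hu
    have hu' : 0 < u := not_le.1 hu
    exact propext ⟨fun h => ⟨hu', h⟩, fun h => h.2⟩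
  have hm : ∀ γ : ℝ, Measurable fun u : ℝ =>
      ENNReal.ofReal (s * Pow * γ * u / (1 + s * Pow * γ * u)) := fun γ => by fun_prop
  rw [Measure.restrict_congr_set hae, setLIntegral_congr_fun measurableSet_Ioo fun u hu =>
    one_sub_lintegral_fadedGainLaw hN hPow hG hg hs hu.1,
    lintegral_add_left ((hm G).const_mul _), lintegral_const_mul _ (hm G),
    lintegral_const_mul _ (hm g), lobeExponent, lobeExponent, thinnedPowerMeasure_eq_smul hp hq0,
    thinnedPowerMeasure_eq_smul hp hq1, Measure.restrict_smul, Measure.restrict_smul,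
    lintegral_smul_measure, lintegral_smul_measure, smul_eq_mul, smul_eq_mul]

/-- Mapping and marking: the link powers, marked with gain and fading, form a Poisson process on the
half line. -/
lemma IsOperatorNetwork.hasPoissonFunctional {Ω : Type*} [MeasurableSpace Ω] {P : Measure Ω}
    [IsProbabilityMeasure P] {d : ℕ → Ω → Plane} {S : ℕ → Ω → LinkState} {θ : ℕ → Ω → ℝ}
    {β : ℕ → Ω → ℂ} (hnet : IsOperatorNetwork P lam p d S θ β) (hlam : 0 < lam)
    (hC : ∀ s, 0 < C s) (hα : ∀ s, 0 < α s)
    (hp : Measurable p) (hp01 : ∀ r, 0 ≤ r → 0 ≤ p r ∧ p r ≤ 1) {N : ℕ} (hN : 1 ≤ N) (G g : ℝ) :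
    HasPoissonFunctional P (thinnedPowerMeasure 1 lam p C α) (fadedGainLaw N G g)
      (fun i ω => linkPower C α (S i ω) ‖d i ω‖) (fadedGain N G g θ β) where
  measurable_point i := (measurable_linkPower C α).comp
    ((hnet.measurable_state i).prodMk (hnet.poisson.measurable_point i).norm)
  measurable_mark := hnet.measurable_fadedGain N G g
  lintegral_iprod Φ hΦ hΦ1 := by
    have := isProbabilityMeasure_fadedGainLaw hN G g
    rw [hnet.lintegral_iprod hp hp01 hN G g C α hΦ hΦ1, ← lintegral_plane_eq_thinnedPowerMeasure
      hlam hC hα hp hp01 (h := fun x => 1 - ∫⁻ w, Φ x w ∂(fadedGainLaw N G g))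
      (measurable_const.sub hΦ.lintegral_prod_right')]

end

end MmWave

open MmWave
theorem lemma3 {Ω : Type*} [MeasurableSpace Ω] (P : Measure Ω) [IsProbabilityMeasure P]
    (lam Pow G g : ℝ) (hlam : 0 < lam) (hPow : 0 < Pow) (hG : 0 ≤ G) (hg : 0 ≤ g)
    (N : ℕ) (hN : 1 ≤ N) (K : ℕ) (hK : 1 ≤ K)
    (C α : LinkState → ℝ) (hC : ∀ s, 0 < C s) (hα : ∀ s, 0 < α s)
    (p : ℝ → ℝ) (hp : Measurable p) (hp01 : ∀ r, 0 ≤ r → 0 ≤ p r ∧ p r ≤ 1)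
    (d : ℕ → Ω → Plane) (S : ℕ → Ω → LinkState) (θ : ℕ → Ω → ℝ) (β : ℕ → Ω → ℂ)
    (hnet : IsOperatorNetwork P lam p d S θ β)
    (A : Ω → Finset ℕ)
    (hA : ∀ᵐ ω ∂P, IsStrongestSet K (fun i => linkPower C α (S i ω) ‖d i ω‖) (A ω))
    (s : ℝ) (hs : 0 ≤ s) :
    laplaceTransform P (interference Pow N G g C α d S θ β A) s =
      ∫⁻ T in Set.Ioi (0 : ℝ),
        EReal.exp (-((lobeExponent (thinnedPowerMeasure (1 / (N : ℝ)) lam p C α) s Pow G T +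
            lobeExponent (thinnedPowerMeasure (1 - 1 / (N : ℝ)) lam p C α) s Pow g T : ℝ≥0∞) :
              EReal)) *
          ENNReal.ofReal (kthPowerPDF lam p C α K T) := by
  have hprob := isProbabilityMeasure_fadedGainLaw hN G g
  have hμ : ∀ {a : ℝ}, 0 < a → thinnedPowerMeasure 1 lam p C α (Set.Ici a) =
      ENNReal.ofReal (totalIntensity lam p C α a) :=
    fun ha => thinnedPowerMeasure_Ici hlam hC hα hp hp01 ha
  have hμr : ∀ {a : ℝ}, 0 < a → (thinnedPowerMeasure 1 lam p C α (Set.Ici a)).toReal =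
      totalIntensity lam p C α a := fun ha => by
    rw [hμ ha, ENNReal.toReal_ofReal (totalIntensity_nonneg hlam hC hp01 ha)]
  have hv : Measurable (Function.uncurry fun u w : ℝ =>
      ENNReal.ofReal s * ENNReal.ofReal (Pow * w * u)) := by
    unfold Function.uncurry
    fun_prop
  have key := (hnet.hasPoissonFunctional hlam hC hα hp hp01 hN G g).lintegral_sum_compl
    thinnedPowerMeasure_Iic (fun ε hε => by rw [hμ hε]; exact ENNReal.ofReal_ne_top)
    (fun ε hε => thinnedPowerMeasure_le hlam hC hα hp01 hε) hv hK
    (aemeasurable_kthPowerPDF hlam hC hα hp hp01 K).ennreal_ofReal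
    ((lintegral_kthPowerPDF_le_one hlam hC hα hp hp01 hK).trans_lt ENNReal.one_lt_top).ne
    (fun a b ha hab => by
      rw [hμr ha, hμr (ha.trans_le hab)]
      exact lintegral_kthPowerPDF hlam hC hα hp hp01 hK ha hab) hA
  simp_rw [lintegral_Iio_eq_lobeExponent hN hPow hG hg hs hp] at key
  refine Eq.trans (lintegral_congr fun ω => ?_) key
  rw [ENNReal.tsum_mul_left]
  simp only [interference, fadedGain, mul_assoc]
  rfl
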